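/- **Setting.** Let $N\cong\mathbb Z^d$ be a lattice with dual lattice $M$, let $E$ be a finite set, let $a=(a_e)_{e\in E}$ be primitive vectors of $N$ which generate $N$, let $r\in\mathbb Z^E$, and let $K$ be a field. Let $\mathcal A$ be the arrangement of the affine hyperplanes $H_e=\{m\in M_{\mathbb R} : \langle m,a_e\rangle+r_e=0\}$, and put $H_e^+=\{m : \langle m,a_e\rangle+r_e\le 0\}$, $H_e^-=\{m : \langle m,a_e\rangle+r_e\ge 0\}$. Let $\Lambda=\{c\in\mathbb Z^E : \sum_e c_ea_e=0\}$, let $\widetilde N=(\mathbb Z^E\oplus\mathbb Z^E)/\{(c,-c) : c\in\Lambda\}$, and let $\rho_e^+,\rho_e^-\in\widetilde N$ be the classes of the $e$-th basis vectors of the two summands. The Lawrence toric variety $\mathfrak B_{\mathcal A}$ is the toric variety over $K$ whose fan in $\widetilde N_{\mathbb R}$ consists of the cones generated by $\{\rho_e^+ : \xi\in H_e^+\}\cup\{\rho_e^- : \xi\in H_e^-\}$, for $\xi$ a vertex of $\mathcal A$, and of all their faces. The map $\widetilde N\to\mathbb Z^E$, $\rho_e^\pm\mapsto\delta_e$, induces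 a toric morphism $\Phi:\mathfrak B_{\mathcal A}\to\mathbb A^E$, and the hypertoric variety $\mathfrak M_{\mathcal A}\subseteq\mathfrak B_{\mathcal A}$ is the preimage under $\Phi$ of the linear subspace of $\mathbb A^E$ cut out by the forms $\sum_e c_ex_e$, $c\in\Lambda$. For a cone $\sigma$ of the fan with torus orbit $O(\sigma)$, say that $\mathfrak M_{\mathcal A}$ meets $O(\sigma)$ *properly* if $\mathfrak M_{\mathcal A}\cap O(\sigma)$ is nonempty and has the expected dimension $\dim\mathfrak M_{\mathcal A}-\dim\sigma$. Say that $\mathcal A$ is a *translate of the coordinate arrangement* if there are a $\mathbb Z$-basis $(b_e)_{e\in E}$ of $N$ and $t\in M_{\mathbb R}$ with $H_e=t+\{m : \langle m,b_e\rangle=0\}$ for all $e\in E$. **Corollary 5.2.** 1. If $\mathcal A$ is not a translate of the coordinate arrangement, then there is a cone $\sigma$ of the fan of $\mathfrak B_{\mathcal A}$ such that $\mathfrak M_{\mathcal A}\cap O(\sigma)$ is nonempty but does not have the expected dimension. 2. If $\mathcal A$ is a translate of the coordinate arrangement, then $\mathfrak M_{\mathcal A}$ meets every torus orbit of $\mathfrak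 B_{\mathcal A}$ properly, and $\mathfrak M_{\mathcal A}\cong\mathbb A^{2d}$ as schemes over $K$. -/

import Mathlib

open CategoryTheory CategoryTheory.Limits AlgebraicGeometry

universe u

/-! ### Rational polyhedral cones -/

namespace Toric

/-- For a lattice `M` with dual lattice `N`, this is `N_ℝ = Hom(M, ℝ)`. -/
abbrev NReal (M : Type u) [AddCommGroup M] : Type u := M →ₗ[ℤ] ℝ

section Cones

variable {M : Type u} [AddCommGroup M]

/-- The canonical map from `N = Hom(M, ℤ)` to `N_ℝ`. -/
def latticeToReal (n : Module.Dual ℤ M) : NReal M := (Int.castAddHom ℝ).toIntLinearMap ∘ₗ n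

/-- A cone in `N_ℝ` generated by finitely many vectors of the lattice `N`. -/
def IsRationalPolyhedral (σ : PointedCone ℝ (NReal M)) : Prop :=
  ∃ s : Finset (Module.Dual ℤ M),
    σ = Submodule.span {c : ℝ // 0 ≤ c} (latticeToReal '' (s : Set (Module.Dual ℤ M)))

/-- The monoid `σ^∨ ∩ M`. -/
def dualMonoid (σ : PointedCone ℝ (NReal M)) : AddSubmonoid M where
  carrier := {u | ∀ x ∈ σ, 0 ≤ x u}
  zero_mem' := fun x _ => by simp
  add_mem' := fun {a b} ha hb x hx => by
    rw [map_add]; exact add_nonneg (ha x hx) (hb x hx)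

/-- The lattice `M(σ) = σ^⊥ ∩ M`. -/
def perpLattice (σ : PointedCone ℝ (NReal M)) : AddSubgroup M where
  carrier := {u | ∀ x ∈ σ, x u = 0}
  zero_mem' := fun x _ => by simp
  add_mem' := fun {a b} ha hb x hx => by rw [map_add, ha x hx, hb x hx, add_zero]
  neg_mem' := fun {a} ha x hx => by rw [map_neg, ha x hx, neg_zero]

/-- `τ` is a face of `σ`: there is `u ∈ σ^∨ ∩ M` with `τ = σ ∩ u^⊥`. -/
def IsFace (τ σ : PointedCone ℝ (NReal M)) : Prop :=
  ∃ u ∈ dualMonoid σ, ∀ x, x ∈ τ ↔ x ∈ σ ∧ x u = 0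

/-- The dimension of a cone, i.e. of its real linear span. -/
noncomputable def coneDim (σ : PointedCone ℝ (NReal M)) : ℕ :=
  Module.finrank ℝ (Submodule.span ℝ (σ : Set (NReal M)))

theorem IsFace.le {τ σ : PointedCone ℝ (NReal M)} (h : IsFace τ σ) : τ ≤ σ := by
  obtain ⟨u, -, h⟩ := h
  exact fun x hx => ((h x).1 hx).1

theorem dualMonoid_anti {τ σ : PointedCone ℝ (NReal M)} (h : τ ≤ σ) :
    dualMonoid σ ≤ dualMonoid τ := fun _ hu x hx => hu x (h hx)

theorem IsFace.refl (σ : PointedCone ℝ (NReal M)) : IsFace σ σ :=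
  ⟨0, zero_mem _, fun x => by simp⟩

theorem nonneg_of_generators (s : Set (NReal M)) (u : M) (h : ∀ x ∈ s, 0 ≤ x u) :
    ∀ x ∈ Submodule.span {c : ℝ // 0 ≤ c} s, 0 ≤ x u := by
  intro x hx
  induction hx using Submodule.span_induction with
  | mem x hx => exact h x hx
  | zero => simp
  | add x y _ _ hx hy => exact add_nonneg hx hy
  | smul c x _ hx => exact mul_nonneg c.2 hx

/-- If `τ = σ ∩ u^⊥` and `v ∈ τ^∨`, then `p u + v ∈ σ^∨` for large `p`. -/
theorem exists_add_mem_dualMonoid {τ σ : PointedCone ℝ (NReal M)} (hσ : IsRationalPolyhedral σ)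
    {u : M} (hu : u ∈ dualMonoid σ) (hτ : ∀ x, x ∈ τ ↔ x ∈ σ ∧ x u = 0)
    {v : M} (hv : v ∈ dualMonoid τ) : ∃ p : ℕ, ∀ q, p ≤ q → q • u + v ∈ dualMonoid σ := by
  obtain ⟨s, hs⟩ := hσ
  have hgen : ∀ g ∈ s, latticeToReal g ∈ σ := fun g hg => by
    rw [hs]; exact Submodule.subset_span ⟨g, hg, rfl⟩
  have key : ∀ g ∈ s, ∃ p : ℕ, ∀ q : ℕ, p ≤ q → 0 ≤ latticeToReal g (q • u + v) := by
    intro g hg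
    have h0 : 0 ≤ latticeToReal g u := hu _ (hgen g hg)
    rcases h0.eq_or_lt with h0 | h0
    · refine ⟨0, fun q _ => ?_⟩
      rw [map_add, map_nsmul, ← h0, smul_zero, zero_add]
      exact hv _ ((hτ _).2 ⟨hgen g hg, h0.symm⟩)
    · obtain ⟨p, hp⟩ := exists_nat_ge (-(latticeToReal g v) / latticeToReal g u)
      refine ⟨p, fun q hq => ?_⟩
      rw [div_le_iff₀ h0] at hp
      rw [map_add, map_nsmul, nsmul_eq_mul]
      have : (p : ℝ) * latticeToReal g u ≤ q * latticeToReal g u :=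
        mul_le_mul_of_nonneg_right (by exact_mod_cast hq) h0.le
      linarith
  choose! p hp using key
  refine ⟨s.sup p, fun q hq => ?_⟩
  change ∀ x ∈ σ, 0 ≤ x (q • u + v)
  rw [hs]
  apply nonneg_of_generators
  rintro _ ⟨g, hg, rfl⟩
  exact hp g hg q ((Finset.le_sup hg).trans hq)

theorem IsFace.isRationalPolyhedral {τ σ : PointedCone ℝ (NReal M)} (h : IsFace τ σ)
    (hσ : IsRationalPolyhedral σ) : IsRationalPolyhedral τ := by
  classical
  obtain ⟨u, hu, hτ⟩ := h
  obtain ⟨s, hs⟩ := hσ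
  refine ⟨s.filter (fun g => g u = 0), le_antisymm ?_ ?_⟩
  · have main : ∀ x ∈ Submodule.span {c : ℝ // 0 ≤ c} (latticeToReal '' (s : Set _)), x u = 0 →
        x ∈ Submodule.span {c : ℝ // 0 ≤ c}
          (latticeToReal '' ((s.filter (fun g => g u = 0) : Finset _) : Set _)) := by
      intro x hx
      induction hx using Submodule.span_induction with
      | mem x hx =>
        obtain ⟨g, hg, rfl⟩ := hx
        intro h0
        refine Submodule.subset_span ⟨g, ?_, rfl⟩
        have h1 : ((g u : ℤ) : ℝ) = 0 := h0
        simpa using ⟨hg, by exact_mod_cast h1⟩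
      | zero => simp
      | add x y hx hy ihx ihy =>
        intro h0
        have h1 := hu x (hs ▸ hx)
        have h2 := hu y (hs ▸ hy)
        have h3 : x u + y u = 0 := h0
        exact add_mem (ihx (by linarith)) (ihy (by linarith))
      | smul c x _ ih =>
        intro h0
        have h3 : (c : ℝ) * x u = 0 := h0
        rcases mul_eq_zero.1 h3 with h | h
        · have : c = 0 := Subtype.ext h
          simp [this]
        · exact Submodule.smul_mem _ _ (ih h)
    intro x hx
    obtain ⟨h1, h2⟩ := (hτ x).1 hx
    exact main x (hs ▸ h1) h2
  · rw [Submodule.span_le]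
    rintro _ ⟨g, hg, rfl⟩
    have hg' : g ∈ s ∧ g u = 0 := by simpa using hg
    refine (hτ _).2 ⟨?_, ?_⟩
    · rw [hs]; exact Submodule.subset_span ⟨g, hg'.1, rfl⟩
    · change ((g u : ℤ) : ℝ) = 0
      rw [hg'.2, Int.cast_zero]

theorem IsFace.trans {ρ τ σ : PointedCone ℝ (NReal M)} (hσ : IsRationalPolyhedral σ)
    (h₁ : IsFace ρ τ) (h₂ : IsFace τ σ) : IsFace ρ σ := by
  obtain ⟨v, hv, hρ⟩ := h₁
  obtain ⟨u, hu, hτ⟩ := h₂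
  obtain ⟨p, hp⟩ := exists_add_mem_dualMonoid hσ hu hτ hv
  refine ⟨u + (p • u + v), add_mem hu (hp p le_rfl), fun x => ?_⟩
  rw [hρ, hτ]
  constructor
  · rintro ⟨⟨h1, h2⟩, h3⟩
    exact ⟨h1, by simp [h2, h3]⟩
  · rintro ⟨h1, h2⟩
    have h3 := hu x h1
    have h4 := hp p le_rfl x h1
    rw [map_add] at h2
    have h5 : x u = 0 := by linarith
    have h6 : x (p • u + v) = 0 := by linarith
    rw [map_add, map_nsmul, h5, smul_zero, zero_add] at h6
    exact ⟨⟨h1, h5⟩, h6⟩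

/-- The intersection of two faces of a cone is a face of both of them. -/
theorem IsFace.inf {τ₁ τ₂ σ : PointedCone ℝ (NReal M)} (h₁ : IsFace τ₁ σ) (h₂ : IsFace τ₂ σ) :
    IsFace (τ₁ ⊓ τ₂) τ₁ ∧ IsFace (τ₁ ⊓ τ₂) τ₂ := by
  obtain ⟨u₁, hu₁, hτ₁⟩ := id h₁
  obtain ⟨u₂, hu₂, hτ₂⟩ := id h₂
  refine ⟨⟨u₂, dualMonoid_anti h₁.le hu₂, fun x => ?_⟩, ⟨u₁, dualMonoid_anti h₂.le hu₁, fun x => ?_⟩⟩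
  · rw [Submodule.mem_inf, hτ₁, hτ₂]; tauto
  · rw [Submodule.mem_inf, hτ₁, hτ₂]; tauto

end Cones

/-! ### Affine toric varieties and their gluing -/

/-- A family of rational polyhedral cones which contains the faces of its members, such as a fan.
(That two cones of a fan intersect in a common face, and that cones are pointed, is not used in
gluing the affine toric varieties of the cones along those of the common faces.) -/
structure ConeSystem (M : Type u) [AddCommGroup M] where
  cones : Set (PointedCone ℝ (NReal M))
  rational : ∀ σ ∈ cones, IsRationalPolyhedral σ
  face_mem : ∀ σ ∈ cones, ∀ τ, IsFace τ σ → τ ∈ cones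

section Affine

variable (K : Type u) [Field K] {M : Type u} [AddCommGroup M]

/-- The coordinate ring `K[σ^∨ ∩ M]` of the affine toric variety `Y_σ`. -/
abbrev CoordRing (σ : PointedCone ℝ (NReal M)) : Type u := AddMonoidAlgebra K (dualMonoid σ)

/-- The character `χ^v` as a regular function on `Y_σ`, for `v ∈ σ^∨ ∩ M`. -/
noncomputable def chi {σ : PointedCone ℝ (NReal M)} (v : dualMonoid σ) : CoordRing K σ :=
  AddMonoidAlgebra.single v 1

/-- The inclusion `K[σ^∨ ∩ M] → K[τ^∨ ∩ M]`, for `τ ⊆ σ`. -/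
noncomputable def coordMap {τ σ : PointedCone ℝ (NReal M)} (h : τ ≤ σ) :
    CoordRing K σ →ₐ[K] CoordRing K τ :=
  AddMonoidAlgebra.mapDomainAlgHom K K (AddSubmonoid.inclusion (dualMonoid_anti h))

theorem coordMap_single {τ σ : PointedCone ℝ (NReal M)} (h : τ ≤ σ) (v : dualMonoid σ) (c : K) :
    coordMap K h (AddMonoidAlgebra.single v c) =
      AddMonoidAlgebra.single (AddSubmonoid.inclusion (dualMonoid_anti h) v) c :=
  AddMonoidAlgebra.mapDomain_single

theorem coordMap_refl (σ : PointedCone ℝ (NReal M)) :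
    (coordMap K (le_refl σ)).toRingHom = RingHom.id (CoordRing K σ) := by
  refine AddMonoidAlgebra.ringHom_ext (fun c => ?_) (fun v => ?_) <;> exact coordMap_single K _ _ _

theorem coordMap_comp {ρ τ σ : PointedCone ℝ (NReal M)} (h₁ : ρ ≤ τ) (h₂ : τ ≤ σ) :
    (coordMap K h₁).toRingHom.comp (coordMap K h₂).toRingHom =
      (coordMap K (h₁.trans h₂)).toRingHom := by
  have key : ∀ (v : dualMonoid σ) (c : K),
      coordMap K h₁ (coordMap K h₂ (AddMonoidAlgebra.single v c)) =
        coordMap K (h₁.trans h₂) (AddMonoidAlgebra.single v c) := fun v c => by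
    rw [coordMap_single, coordMap_single, coordMap_single]; rfl
  exact AddMonoidAlgebra.ringHom_ext (fun c => key _ c) (fun v => key v 1)

/-- For `τ = σ ∩ u^⊥`, the ring `K[τ^∨ ∩ M]` is the localization of `K[σ^∨ ∩ M]` at `χ^u`. -/
theorem isLocalization_coordMap {τ σ : PointedCone ℝ (NReal M)} (hσ : IsRationalPolyhedral σ)
    (h : τ ≤ σ) {u : M} (hu : u ∈ dualMonoid σ) (hτ : ∀ x, x ∈ τ ↔ x ∈ σ ∧ x u = 0) :
    letI := (coordMap K h).toRingHom.toAlgebra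
    IsLocalization.Away (chi K ⟨u, hu⟩) (CoordRing K τ) := by
  let _ := (coordMap K h).toRingHom.toAlgebra
  have halg : ∀ f : CoordRing K σ, algebraMap (CoordRing K σ) (CoordRing K τ) f = coordMap K h f :=
    fun _ => rfl
  have hneg : -u ∈ dualMonoid τ := fun x hx => by
    rw [map_neg, ((hτ x).1 hx).2, neg_zero]
  have hinj : Function.Injective (coordMap K h) :=
    AddMonoidAlgebra.mapDomain_injective (AddSubmonoid.inclusion_injective _)
  apply IsLocalization.Away.mk
  · refine IsUnit.of_mul_eq_one (AddMonoidAlgebra.single ⟨-u, hneg⟩ 1) ?_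
    rw [halg, chi, coordMap_single, AddMonoidAlgebra.single_mul_single, AddMonoidAlgebra.one_def]
    congr 1
    · exact Subtype.ext (add_neg_cancel u)
    · simp
  · intro f
    have hpow : ∀ n : ℕ, algebraMap (CoordRing K σ) (CoordRing K τ) (chi K ⟨u, hu⟩) ^ n =
        AddMonoidAlgebra.single ⟨n • u, nsmul_mem (dualMonoid_anti h hu) n⟩ 1 := by
      intro n
      rw [halg, chi, coordMap_single, AddMonoidAlgebra.single_pow, one_pow]
      rfl
    have main : ∃ n : ℕ, ∀ q, n ≤ q → ∃ a : CoordRing K σ,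
        f * algebraMap (CoordRing K σ) (CoordRing K τ) (chi K ⟨u, hu⟩) ^ q =
          algebraMap (CoordRing K σ) (CoordRing K τ) a := by
      induction f using AddMonoidAlgebra.induction_linear with
      | zero => exact ⟨0, fun q _ => ⟨0, by simp⟩⟩
      | add f g hf hg =>
        obtain ⟨n, hn⟩ := hf
        obtain ⟨m, hm⟩ := hg
        refine ⟨max n m, fun q hq => ?_⟩
        obtain ⟨a, ha⟩ := hn q (le_trans (le_max_left _ _) hq)
        obtain ⟨b, hb⟩ := hm q (le_trans (le_max_right _ _) hq)
        exact ⟨a + b, by rw [add_mul, ha, hb, map_add]⟩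
      | single v c =>
        obtain ⟨p, hp⟩ := exists_add_mem_dualMonoid hσ hu hτ v.2
        refine ⟨p, fun q hq => ⟨AddMonoidAlgebra.single ⟨q • u + v, hp q hq⟩ c, ?_⟩⟩
        rw [hpow, halg, coordMap_single, AddMonoidAlgebra.single_mul_single, mul_one]
        congr 1
        exact Subtype.ext (add_comm _ _)
    obtain ⟨n, hn⟩ := main
    exact ⟨n, hn n le_rfl⟩
  · intro a b hab
    exact ⟨0, by rw [hinj hab]⟩

/-- The affine toric variety `Y_σ = Spec K[σ^∨ ∩ M]`. -/
noncomputable abbrev affineToric (σ : PointedCone ℝ (NReal M)) : Scheme.{u} :=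
  Spec (CommRingCat.of (CoordRing K σ))

/-- The morphism `Y_τ → Y_σ` for `τ ⊆ σ`. -/
noncomputable abbrev affineToricMap {τ σ : PointedCone ℝ (NReal M)} (h : τ ≤ σ) :
    affineToric K τ ⟶ affineToric K σ :=
  Spec.map (CommRingCat.ofHom (coordMap K h).toRingHom)

theorem affineToricMap_refl (σ : PointedCone ℝ (NReal M)) :
    affineToricMap K (le_refl σ) = 𝟙 (affineToric K σ) := by
  rw [affineToricMap, coordMap_refl]
  exact Spec.map_id _

theorem affineToricMap_comp {ρ τ σ : PointedCone ℝ (NReal M)} (h₁ : ρ ≤ τ) (h₂ : τ ≤ σ) :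
    affineToricMap K h₁ ≫ affineToricMap K h₂ = affineToricMap K (h₁.trans h₂) := by
  rw [affineToricMap, affineToricMap, ← Spec.map_comp, ← CommRingCat.ofHom_comp, coordMap_comp]

theorem isOpenImmersion_affineToricMap {τ σ : PointedCone ℝ (NReal M)}
    (hσ : IsRationalPolyhedral σ) (h : IsFace τ σ) :
    IsOpenImmersion (affineToricMap K h.le) := by
  obtain ⟨u, hu, hτ⟩ := id h
  let _ := (coordMap K h.le).toRingHom.toAlgebra
  have := isLocalization_coordMap K hσ h.le hu hτ
  exact IsOpenImmersion.of_isLocalization (S := CoordRing K τ) (chi K ⟨u, hu⟩)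

theorem range_affineToricMap {τ σ : PointedCone ℝ (NReal M)} (hσ : IsRationalPolyhedral σ)
    (h : τ ≤ σ) {u : M} (hu : u ∈ dualMonoid σ) (hτ : ∀ x, x ∈ τ ↔ x ∈ σ ∧ x u = 0) :
    Set.range (affineToricMap K h) = ((PrimeSpectrum.basicOpen (chi K ⟨u, hu⟩) :
      TopologicalSpace.Opens (PrimeSpectrum (CoordRing K σ))) : Set (PrimeSpectrum _)) := by
  let _ := (coordMap K h).toRingHom.toAlgebra
  have := isLocalization_coordMap K hσ h hu hτ
  exact PrimeSpectrum.localization_away_comap_range (CoordRing K τ) (chi K ⟨u, hu⟩)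

end Affine

namespace ConeSystem

variable {M : Type u} [AddCommGroup M] (Δ : ConeSystem M)

/-- The cones of `Δ`, as the objects of a category in which the morphisms are the face relations. -/
structure Cone where
  cone : PointedCone ℝ (NReal M)
  mem : cone ∈ Δ.cones

instance : Preorder Δ.Cone where
  le τ σ := IsFace τ.cone σ.cone
  le_refl σ := IsFace.refl σ.cone
  le_trans _ _ σ h₁ h₂ := h₁.trans (Δ.rational _ σ.mem) h₂

theorem Cone.isFace {τ σ : Δ.Cone} (f : τ ⟶ σ) : IsFace τ.cone σ.cone := leOfHom f

variable (K : Type u) [Field K]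

/-- The diagram of the affine toric varieties `Y_σ` and the open immersions `Y_τ → Y_σ`,
`τ` a face of `σ`. -/
noncomputable def diagram : Δ.Cone ⥤ Scheme.{u} where
  obj σ := affineToric K σ.cone
  map f := affineToricMap K (Cone.isFace Δ f).le
  map_id σ := affineToricMap_refl K σ.cone
  map_comp f g := (affineToricMap_comp K (Cone.isFace Δ f).le (Cone.isFace Δ g).le).symm

instance {τ σ : Δ.Cone} (f : τ ⟶ σ) : IsOpenImmersion ((Δ.diagram K).map f) :=
  isOpenImmersion_affineToricMap K (Δ.rational _ σ.mem) (Cone.isFace Δ f)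

instance : (Δ.diagram K ⋙ Scheme.forget).IsLocallyDirected where
  cond {τ₁ τ₂ σ} f₁ f₂ x₁ x₂ h := by
    have hσ := Δ.rational _ σ.mem
    have hf₁ := Cone.isFace Δ f₁
    have hf₂ := Cone.isFace Δ f₂
    obtain ⟨u₁, hu₁, hτ₁⟩ := id hf₁
    obtain ⟨u₂, hu₂, hτ₂⟩ := id hf₂
    obtain ⟨hi₁, hi₂⟩ := hf₁.inf hf₂
    have hρ : ∀ x, x ∈ τ₁.cone ⊓ τ₂.cone ↔ x ∈ σ.cone ∧ x (u₁ + u₂) = 0 := by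
      intro x
      rw [Submodule.mem_inf, hτ₁, hτ₂, map_add]
      constructor
      · rintro ⟨⟨h1, h2⟩, -, h3⟩
        exact ⟨h1, by rw [h2, h3, add_zero]⟩
      · rintro ⟨h1, h2⟩
        have h3 := hu₁ x h1
        have h4 := hu₂ x h1
        exact ⟨⟨h1, by linarith⟩, h1, by linarith⟩
    let ρ : Δ.Cone := ⟨τ₁.cone ⊓ τ₂.cone, Δ.face_mem _ τ₁.mem _ hi₁⟩
    let g₁ : ρ ⟶ τ₁ := homOfLE hi₁
    let g₂ : ρ ⟶ τ₂ := homOfLE hi₂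
    have h : (Δ.diagram K).map f₁ x₁ = (Δ.diagram K).map f₂ x₂ := h
    have hmem : (Δ.diagram K).map f₁ x₁ ∈ Set.range ((Δ.diagram K).map (g₁ ≫ f₁)) := by
      have e₁ := range_affineToricMap K hσ hf₁.le hu₁ hτ₁
      have e₂ := range_affineToricMap K hσ hf₂.le hu₂ hτ₂
      have e₃ := range_affineToricMap K hσ (hi₁.le.trans hf₁.le) (add_mem hu₁ hu₂) hρ
      have m₁ : (Δ.diagram K).map f₁ x₁ ∈ Set.range (affineToricMap K hf₁.le) := ⟨x₁, rfl⟩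
      have m₂ : (Δ.diagram K).map f₁ x₁ ∈ Set.range (affineToricMap K hf₂.le) := ⟨x₂, h.symm⟩
      change _ ∈ Set.range (affineToricMap K (hi₁.le.trans hf₁.le))
      rw [e₁] at m₁
      rw [e₂] at m₂
      rw [e₃]
      have hmul : chi K (σ := σ.cone) ⟨u₁ + u₂, add_mem hu₁ hu₂⟩ =
          chi K ⟨u₁, hu₁⟩ * chi K ⟨u₂, hu₂⟩ := by
        rw [chi, chi, chi, AddMonoidAlgebra.single_mul_single, mul_one]
        rfl
      rw [hmul, PrimeSpectrum.basicOpen_mul]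
      exact ⟨m₁, m₂⟩
    obtain ⟨y, hy⟩ := hmem
    have hy₂ : (Δ.diagram K).map (g₂ ≫ f₂) y = (Δ.diagram K).map f₂ x₂ := by
      rw [← h, ← hy]; rfl
    rw [Functor.map_comp, Scheme.Hom.comp_apply] at hy hy₂
    exact ⟨ρ, g₁, g₂, y, ((Δ.diagram K).map f₁).isOpenEmbedding.injective hy,
      ((Δ.diagram K).map f₂).isOpenEmbedding.injective hy₂⟩

/-- The toric variety `Y_Δ`, obtained by gluing the `Y_σ` along the `Y_τ`, `τ` a face of `σ`. -/
noncomputable def toricVariety : Scheme.{u} := colimit (Δ.diagram K)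

/-- The open immersion `Y_σ → Y_Δ`. -/
noncomputable def chart (σ : Δ.Cone) : affineToric K σ.cone ⟶ Δ.toricVariety K :=
  colimit.ι (Δ.diagram K) σ

/-- Morphisms `Y_σ → X` which agree with the face inclusions glue to a morphism `Y_Δ → X`. -/
noncomputable def glueHom {X : Scheme.{u}} (f : ∀ σ : Δ.Cone, affineToric K σ.cone ⟶ X)
    (hf : ∀ (τ σ : Δ.Cone) (h : τ.cone ≤ σ.cone), affineToricMap K h ≫ f σ = f τ) :
    Δ.toricVariety K ⟶ X :=
  colimit.desc (Δ.diagram K)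
    { pt := X
      ι :=
        { app := f
          naturality := fun τ σ g =>
            (hf τ σ (Cone.isFace Δ g).le).trans (Category.comp_id _).symm } }

/-- The structure morphism `Y_Δ → Spec K`. -/
noncomputable def toSpecField : Δ.toricVariety K ⟶ Spec (CommRingCat.of K) :=
  Δ.glueHom K (fun σ => Spec.map (CommRingCat.ofHom (algebraMap K (CoordRing K σ.cone))))
    (fun τ σ h => by
      rw [affineToricMap, ← Spec.map_comp, ← CommRingCat.ofHom_comp]
      congr 2
      exact (coordMap K h).comp_algebraMap)

/-- The morphism `Y_Δ → 𝔸^E` with coordinates the characters `χ^{u_e}`, where each `u_e ∈ M` lies in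
`σ^∨` for every cone `σ` of `Δ`. This is the toric morphism given by the map of lattices `N → ℤ^E`,
`n ↦ (⟨u_e, n⟩)_e`, which maps every cone of `Δ` into the orthant. -/
noncomputable def toAffineSpace {E : Type u} (v : E → M)
    (hv : ∀ σ ∈ Δ.cones, ∀ e, v e ∈ dualMonoid σ) :
    Δ.toricVariety K ⟶ Spec (CommRingCat.of (MvPolynomial E K)) :=
  Δ.glueHom K
    (fun σ => Spec.map (CommRingCat.ofHom
      (MvPolynomial.aeval (R := K) (fun e => chi K (σ := σ.cone) ⟨v e, hv _ σ.mem e⟩)).toRingHom))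
    (fun τ σ h => by
      rw [affineToricMap, ← Spec.map_comp, ← CommRingCat.ofHom_comp]
      congr 2
      have : (coordMap K h).comp
          (MvPolynomial.aeval (R := K) (fun e => chi K (σ := σ.cone) ⟨v e, hv _ σ.mem e⟩)) =
          MvPolynomial.aeval (R := K) (fun e => chi K (σ := τ.cone) ⟨v e, hv _ τ.mem e⟩) := by
        refine MvPolynomial.algHom_ext (fun e => ?_)
        rw [AlgHom.comp_apply, MvPolynomial.aeval_X, MvPolynomial.aeval_X]
        exact coordMap_single K h _ 1
      exact congrArg AlgHom.toRingHom this)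

end ConeSystem

/-! ### Torus orbits -/

section Orbits

variable (K : Type u) [Field K] {M : Type u} [AddCommGroup M]

open Classical in
/-- The surjection `K[σ^∨ ∩ M] → K[σ^⊥ ∩ M]` which maps `χ^v` to `χ^v` if `v ∈ σ^⊥`, and to `0`
otherwise. -/
noncomputable def orbitHom (σ : PointedCone ℝ (NReal M)) :
    CoordRing K σ →ₐ[K] AddMonoidAlgebra K (perpLattice σ) :=
  AddMonoidAlgebra.lift K (AddMonoidAlgebra K (perpLattice σ)) (dualMonoid σ)
    { toFun := fun v =>
        if h : (v.toAdd : M) ∈ perpLattice σ then AddMonoidAlgebra.single ⟨v.toAdd, h⟩ 1 else 0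
      map_one' := dif_pos (zero_mem (perpLattice σ))
      map_mul' := fun v w => by
        have hiff : ((v * w).toAdd : M) ∈ perpLattice σ ↔
            (v.toAdd : M) ∈ perpLattice σ ∧ (w.toAdd : M) ∈ perpLattice σ := by
          constructor
          · intro h
            have h' : ∀ x ∈ σ, x (v.toAdd : M) + x (w.toAdd : M) = 0 := fun x hx => by
              rw [← map_add]; exact h x hx
            refine ⟨fun x hx => ?_, fun x hx => ?_⟩ <;>
            · have h1 : 0 ≤ x (v.toAdd : M) := v.toAdd.2 x hx
              have h2 : 0 ≤ x (w.toAdd : M) := w.toAdd.2 x hx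
              linarith [h' x hx]
          · rintro ⟨h1, h2⟩
            exact add_mem h1 h2
        by_cases h1 : (v.toAdd : M) ∈ perpLattice σ
        · by_cases h2 : (w.toAdd : M) ∈ perpLattice σ
          · rw [dif_pos (hiff.2 ⟨h1, h2⟩), dif_pos h1, dif_pos h2,
              AddMonoidAlgebra.single_mul_single, mul_one]
            rfl
          · rw [dif_neg (fun h => h2 (hiff.1 h).2), dif_neg h2, mul_zero]
        · rw [dif_neg (fun h => h1 (hiff.1 h).1), dif_neg h1, zero_mul] }

/-- The torus `O(σ) = Spec K[σ^⊥ ∩ M]`. -/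
noncomputable abbrev torusOrbit (σ : PointedCone ℝ (NReal M)) : Scheme.{u} :=
  Spec (CommRingCat.of (AddMonoidAlgebra K (perpLattice σ)))

/-- The torus orbit `O(σ) → Y_Δ` of a cone `σ` of `Δ`: the closed immersion `O(σ) → Y_σ` followed by
the open immersion `Y_σ → Y_Δ`. -/
noncomputable def ConeSystem.orbitMap (Δ : ConeSystem M) (σ : Δ.Cone) :
    torusOrbit K σ.cone ⟶ Δ.toricVariety K :=
  Spec.map (CommRingCat.ofHom (orbitHom K σ.cone).toRingHom) ≫ Δ.chart K σ

/-- The intersection of `i : X → Y_Δ` (a closed subscheme, say) with the torus orbit `O(σ)`. -/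
noncomputable def ConeSystem.orbitInter (Δ : ConeSystem M) {X : Scheme.{u}}
    (i : X ⟶ Δ.toricVariety K) (σ : Δ.Cone) : Scheme.{u} :=
  pullback i (Δ.orbitMap K σ)

/-- `X ∩ O(σ)` has the expected dimension `dim X - dim σ`. -/
def ConeSystem.HasExpectedDim (Δ : ConeSystem M) {X : Scheme.{u}}
    (i : X ⟶ Δ.toricVariety K) (σ : Δ.Cone) : Prop :=
  topologicalKrullDim (Δ.orbitInter K i σ) + (coneDim σ.cone : WithBot ℕ∞) = topologicalKrullDim X

end Orbits

end Toric

/-! ### Arrangements -/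

open Toric

/-- The data `(a, r)` of an arrangement of affine hyperplanes: a tuple `a` of vectors of a lattice
`N` and a tuple `r` of integers, both indexed by `E`. -/
structure Arrangement (E N : Type u) where
  a : E → N
  r : E → ℤ

namespace Arrangement

variable {E N : Type u} [AddCommGroup N] (A : Arrangement E N)

/-- `a` is a primitive spanning configuration: the `a_e` are primitive and generate the lattice. -/
structure IsPrimitiveSpanning : Prop where
  primitive : ∀ e, ∀ (n : ℤ) (x : N), A.a e = n • x → IsUnit n
  spanning : Submodule.span ℤ (Set.range A.a) = ⊤

/-- For `M` the dual lattice of `N`, this is `M_ℝ = Hom(N, ℝ)`. -/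
abbrev MReal (N : Type u) [AddCommGroup N] : Type u := N →ₗ[ℤ] ℝ

/-- The hyperplane `H_e`. -/
def hyperplane (e : E) : Set (MReal N) := {m | m (A.a e) + A.r e = 0}

/-- The halfspace `H_e^+`. -/
def posHalf (e : E) : Set (MReal N) := {m | m (A.a e) + A.r e ≤ 0}

/-- The halfspace `H_e^-`. -/
def negHalf (e : E) : Set (MReal N) := {m | 0 ≤ m (A.a e) + A.r e}

/-- The sign vector of a point: the sign at `e` is `+` on `H_e^+ \ H_e`, `0` on `H_e` and `-` on
`H_e^- \ H_e`. -/
noncomputable def sgn (m : MReal N) (e : E) : SignType := SignType.sign (-(m (A.a e) + A.r e))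

/-- A face of the arrangement is a nonempty fibre of the sign map. -/
def IsFace (R : Set (MReal N)) : Prop := ∃ m, R = {m' | A.sgn m' = A.sgn m}

/-- A vertex is a face consisting of a single point. -/
def IsVertex (ξ : MReal N) : Prop := A.IsFace {ξ}

/-- The arrangement is a translate of the arrangement of coordinate hyperplanes, with respect to
some basis of the lattice (indexed by `E`, so that there are as many hyperplanes as coordinates). -/
def IsTranslateOfCoordinate : Prop :=
  ∃ (b : Module.Basis E ℤ N) (t : MReal N),
    ∀ e, A.hyperplane e = (fun m => t + m) '' {m : MReal N | m (b e) = 0}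

/-! ### The Lawrence toric variety -/

variable [Fintype E]

/-- The lattice `Λ ⊆ ℤ^E` of the relations among the `a_e`. -/
def relations : Submodule ℤ (E → ℤ) := LinearMap.ker (Fintype.linearCombination ℤ A.a)

/-- The antidiagonal embedding `∇ : ℤ^E → ℤ^E ⊕ ℤ^E`. -/
def antidiag (E : Type u) : (E → ℤ) →ₗ[ℤ] (E → ℤ) × (E → ℤ) :=
  LinearMap.prod LinearMap.id (-LinearMap.id)

/-- The lattice `Ñ`, the cokernel of `Λ → ℤ^E ⊕ ℤ^E`. -/
abbrev NTilde : Type u := ((E → ℤ) × (E → ℤ)) ⧸ A.relations.map (antidiag E)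

/-- The dual lattice of `Ñ`. -/
abbrev MTilde : Type u := Module.Dual ℤ A.NTilde

/-- The surjection `Ñ → ℤ^E`, `ρ_e^± ↦ δ_e`. -/
def sumMap : A.NTilde →ₗ[ℤ] (E → ℤ) :=
  (A.relations.map (antidiag E)).liftQ
    (LinearMap.fst ℤ (E → ℤ) (E → ℤ) + LinearMap.snd ℤ (E → ℤ) (E → ℤ)) (by
      rintro _ ⟨c, -, rfl⟩
      simp [antidiag])

/-- The `e`-th coordinate of `Ñ → ℤ^E`, an element of the dual lattice of `Ñ`. -/
def coordChar (e : E) : A.MTilde := LinearMap.proj e ∘ₗ A.sumMap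

variable [DecidableEq E]

/-- `ρ_e^+`. -/
def rhoPos (e : E) : A.NTilde := Submodule.Quotient.mk (Pi.single e 1, 0)

/-- `ρ_e^-`. -/
def rhoNeg (e : E) : A.NTilde := Submodule.Quotient.mk (0, Pi.single e 1)

/-- The generators of the cone `σ_{E, R}` of a face `R`: the vectors `ρ_e^+` for `R ⊆ H_e^+` and
`ρ_e^-` for `R ⊆ H_e^-`. -/
def coneGenerators (R : Set (MReal N)) : Set A.NTilde :=
  {n | ∃ e, (R ⊆ A.posHalf e ∧ n = A.rhoPos e) ∨ (R ⊆ A.negHalf e ∧ n = A.rhoNeg e)}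

/-- The cone `σ_{E, R}` in `Ñ_ℝ`. -/
def lawrenceCone (R : Set (MReal N)) : PointedCone ℝ (NReal A.MTilde) :=
  Submodule.span {c : ℝ // 0 ≤ c}
    ((fun n => latticeToReal (Module.Dual.eval ℤ A.NTilde n)) '' A.coneGenerators R)

theorem coneGenerators_finite (R : Set (MReal N)) : (A.coneGenerators R).Finite := by
  refine ((Set.finite_range A.rhoPos).union (Set.finite_range A.rhoNeg)).subset ?_
  rintro n ⟨e, ⟨-, rfl⟩ | ⟨-, rfl⟩⟩
  · exact Or.inl ⟨e, rfl⟩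
  · exact Or.inr ⟨e, rfl⟩

theorem lawrenceCone_rational (R : Set (MReal N)) : IsRationalPolyhedral (A.lawrenceCone R) := by
  refine ⟨((A.coneGenerators_finite R).image (Module.Dual.eval ℤ A.NTilde)).toFinset, ?_⟩
  rw [Set.Finite.coe_toFinset, Set.image_image]
  rfl

/-- The Lawrence fan: the cones `σ_{E, ξ}`, for `ξ` a vertex, together with all of their faces. -/
def lawrenceFan : ConeSystem A.MTilde where
  cones := {τ | ∃ ξ, A.IsVertex ξ ∧ Toric.IsFace τ (A.lawrenceCone {ξ})}
  rational := by
    rintro τ ⟨ξ, -, h⟩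
    exact h.isRationalPolyhedral (A.lawrenceCone_rational _)
  face_mem := by
    rintro σ ⟨ξ, hξ, h⟩ τ hτ
    exact ⟨ξ, hξ, hτ.trans (A.lawrenceCone_rational _) h⟩

theorem coordChar_mem (σ : PointedCone ℝ (NReal A.MTilde)) (hσ : σ ∈ A.lawrenceFan.cones) (e : E) :
    A.coordChar e ∈ dualMonoid σ := by
  obtain ⟨ξ, -, h⟩ := hσ
  refine dualMonoid_anti h.le ?_
  apply nonneg_of_generators
  rintro _ ⟨n, ⟨f, hf⟩, rfl⟩
  change (0 : ℝ) ≤ ((A.sumMap n e : ℤ) : ℝ)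
  have key : ∀ g : E → ℤ, g = Pi.single f 1 → 0 ≤ g e := by
    rintro _ rfl
    by_cases hfe : e = f
    · subst hfe; simp
    · simp [hfe]
  rcases hf with ⟨-, rfl⟩ | ⟨-, rfl⟩
  · exact_mod_cast key _ (by simp [sumMap, rhoPos])
  · exact_mod_cast key _ (by simp [sumMap, rhoNeg])

variable (K : Type u) [Field K]

/-- The Lawrence toric variety. -/
noncomputable def lawrenceVariety : Scheme.{u} := A.lawrenceFan.toricVariety K

/-- The morphism `Φ` from the Lawrence toric variety to `𝔸^E`, induced by `Ñ → ℤ^E`. -/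
noncomputable def lawrenceToAffine : A.lawrenceVariety K ⟶ Spec (CommRingCat.of (MvPolynomial E K)) :=
  A.lawrenceFan.toAffineSpace K A.coordChar A.coordChar_mem

/-! ### The hypertoric variety -/

/-- The ideal generated by the linear forms `∑ c_e x_e`, for the relations `∑ c_e a_e = 0`. -/
noncomputable def linearIdeal : Ideal (MvPolynomial E K) :=
  Ideal.span {p | ∃ c ∈ A.relations, p = ∑ e, MvPolynomial.C (c e : K) * MvPolynomial.X e}

/-- The linear subspace of `𝔸^E` defined by the linear forms above. -/
noncomputable def linearSpace : Scheme.{u} :=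
  Spec (CommRingCat.of (MvPolynomial E K ⧸ A.linearIdeal K))

/-- The closed immersion of the linear subspace in `𝔸^E`. -/
noncomputable def linearSpaceMap :
    A.linearSpace K ⟶ Spec (CommRingCat.of (MvPolynomial E K)) :=
  Spec.map (CommRingCat.ofHom (Ideal.Quotient.mk (A.linearIdeal K)))

/-- The hypertoric variety: the preimage of the linear subspace under `Φ`. -/
noncomputable def hypertoric : Scheme.{u} :=
  pullback (A.lawrenceToAffine K) (A.linearSpaceMap K)

/-- The embedding of the hypertoric variety in the Lawrence toric variety. -/
noncomputable def lawrenceEmbedding : A.hypertoric K ⟶ A.lawrenceVariety K :=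
  pullback.fst (A.lawrenceToAffine K) (A.linearSpaceMap K)

/-- The hypertoric variety meets the torus orbit of `σ`. -/
def Meets (σ : A.lawrenceFan.Cone) : Prop :=
  Nonempty (A.lawrenceFan.orbitInter K (A.lawrenceEmbedding K) σ)

/-- The hypertoric variety meets the torus orbit of `σ` properly, i.e. in a nonempty scheme of the
expected dimension. -/
def MeetsProperly (σ : A.lawrenceFan.Cone) : Prop :=
  A.Meets K σ ∧ A.lawrenceFan.HasExpectedDim K (A.lawrenceEmbedding K) σ

/-- The structure morphism of the hypertoric variety. -/
noncomputable def hypertoricToSpec : A.hypertoric K ⟶ Spec (CommRingCat.of K) :=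
  A.lawrenceEmbedding K ≫ A.lawrenceFan.toSpecField K

end Arrangement

/-! ### Krull dimension and transcendence degree -/

section TranscendenceDegree

/-! Everything hinges on whether the relation lattice `Λ` vanishes. The `a_e` generate `N`, so `Λ =
0` means that they form a basis. The arrangement is then a translate of the coordinate one;
conversely, a translate forces `a_e = ±b_e` by primitivity, and `Λ = 0`.

If `Λ ≠ 0`, properness fails at the cone of a vertex. That cone has full dimension `rank Ñ`
(`coneDim_lawrenceCone`). Its orbit lies over the origin of `𝔸^E`, because every coordinate
character is positive on some generator (`coordChar_notMem_perpLattice`), so the hypertoric variety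
meets it (`meets_of_forall_notMem`). The linear form of a suitable relation pulls back to a nonzero
function on every chart, and charts are spectra of domains of dimension at most `rank Ñ`; hence the
hypertoric variety has dimension less than `rank Ñ` (`topologicalKrullDim_hypertoric_le`). The
expected dimension would be negative, but a nonempty scheme has dimension at least `0`. The exact
dimension of the hypertoric variety is never needed.

If `Λ = 0`, the linear subspace is all of `𝔸^E` and the hypertoric variety is the whole Lawrence
variety. The `ρ_e^±` form a basis of `Ñ`, the only vertex lies on all hyperplanes, and the fan
consists of the faces of one orthant of dimension `2d`. So the variety is `𝔸^{2d}`, and the orbit of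
a face has complementary dimension.

The commutative algebra behind this is the bound of Krull dimension by transcendence degree for
domains over a field, without finite generation, and the dimension of the algebra of a lattice. -/

theorem AlgebraicIndependent.of_algHom_comp {K A B ι : Type*} [CommRing K] [CommRing A]
    [CommRing B] [Algebra K A] [Algebra K B] (f : A →ₐ[K] B) {y : ι → A}
    (hy : AlgebraicIndependent K (f ∘ y)) : AlgebraicIndependent K y := by
  rw [algebraicIndependent_iff_injective_aeval] at hy ⊢
  have h : ⇑(MvPolynomial.aeval (f ∘ y) : MvPolynomial ι K →ₐ[K] B) =
      f ∘ (MvPolynomial.aeval y : MvPolynomial ι K →ₐ[K] A) := by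
    funext p
    exact (MvPolynomial.comp_aeval_apply y f p).symm
  rw [h] at hy
  exact hy.of_comp

/-- A nonzero element of the kernel of a map out of a domain is independent of any family whose
image is algebraically independent. -/
theorem AlgebraicIndependent.option_of_map {K A B ι : Type*} [Field K] [CommRing A] [IsDomain A]
    [CommRing B] [Algebra K A] [Algebra K B] (f : A →ₐ[K] B) {y : ι → A}
    (hy : AlgebraicIndependent K (f ∘ y)) {x : A} (hx : x ≠ 0) (hfx : f x = 0) :
    AlgebraicIndependent K (fun o : Option ι => o.elim x y) := by
  have hy' : AlgebraicIndependent K y := hy.of_algHom_comp f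
  rw [hy'.option_iff_transcendental]
  -- Independence of `f ∘ y` makes `f` injective on `K[y]`, which contains the coefficients of any
  -- equation for `x`.
  have hinj : ∀ c ∈ Algebra.adjoin K (Set.range y), f c = 0 → c = 0 := by
    intro c hc h0
    rw [Algebra.adjoin_range_eq_range_aeval] at hc
    obtain ⟨p, rfl⟩ := hc
    have h1 : MvPolynomial.aeval (f ∘ y) p = 0 := by
      rw [← h0]
      exact (MvPolynomial.comp_aeval_apply y f p).symm
    have := (injective_iff_map_eq_zero _).1 hy p h1
    simp [this]
  rw [transcendental_iff]
  intro p hp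
  by_contra hp0
  -- Strip the powers of the variable from the equation `p(x) = 0`; since `x ≠ 0` in a domain, `q(x)
  -- = 0` with `q(0) ≠ 0`. But `f` kills `x`, so it kills `q(0)`, against the injectivity above.
  obtain ⟨q, hq, hq0⟩ := Polynomial.exists_eq_pow_rootMultiplicity_mul_and_not_dvd p hp0 0
  rw [Polynomial.C_0, sub_zero] at hq hq0
  rw [hq, map_mul, map_pow, Polynomial.aeval_X, mul_eq_zero] at hp
  have hq1 : Polynomial.aeval x q = 0 := hp.resolve_left (pow_ne_zero _ hx)
  rw [Polynomial.X_dvd_iff] at hq0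
  apply hq0
  have h2 := congrArg (Polynomial.aeval x) (Polynomial.divX_mul_X_add q)
  rw [hq1, map_add, map_mul, Polynomial.aeval_X, Polynomial.aeval_C] at h2
  have h3 := congrArg f h2
  rw [map_add, map_mul, hfx, mul_zero, zero_add, map_zero] at h3
  exact Subtype.ext (hinj _ (q.coeff 0).2 h3)

/-- Descending one prime in the chain gives a surjection of quotient domains with nonzero kernel.
Lifts of the independent family from the larger prime, together with a nonzero element of the
kernel, form a family with one more member. -/
theorem exists_algebraicIndependent_of_ltSeries (K : Type*) {R : Type*} [Field K] [CommRing R]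
    [Algebra K R] (k : ℕ) : ∀ l : LTSeries (PrimeSpectrum R), l.length = k →
      ∃ x : Fin k → R ⧸ l.head.asIdeal, AlgebraicIndependent K x := by
  induction k with
  | zero =>
    intro l _
    exact ⟨Fin.elim0, algebraicIndependent_empty_type⟩
  | succ k ih =>
    intro l hl
    have hl0 : l.length ≠ 0 := by omega
    obtain ⟨x, hx⟩ := ih (l.tail hl0) (by simp [hl])
    have hlt : l.head < (l.tail hl0).head := by
      rw [RelSeries.head_tail]
      have h1 := l.step ⟨0, by omega⟩
      -- The numeral `1` in `Fin (l.length + 1)` is taken modulo `l.length + 1`, so this needs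
      -- `l.length ≠ 0`.
      have h2 : (⟨0, by omega⟩ : Fin l.length).succ = 1 := by
        ext
        rw [Fin.val_succ, Fin.val_one', Nat.mod_eq_of_lt (by omega)]
      rw [h2] at h1
      exact h1
    have hle : l.head.asIdeal ≤ (l.tail hl0).head.asIdeal := hlt.le
    obtain ⟨z, hz, hz'⟩ := Set.exists_of_ssubset hlt
    let f : R ⧸ l.head.asIdeal →ₐ[K] R ⧸ (l.tail hl0).head.asIdeal :=
      Ideal.Quotient.factorₐ K hle
    have hf : Function.Surjective f := Ideal.Quotient.factor_surjective hle
    choose y hy using fun i => hf (x i)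
    have hfy : f ∘ y = x := funext hy
    have key := AlgebraicIndependent.option_of_map f (y := y) (hfy ▸ hx)
      (x := Ideal.Quotient.mk _ z) (by rwa [Ne, Ideal.Quotient.eq_zero_iff_mem])
      (by
        change Ideal.Quotient.mk (l.tail hl0).head.asIdeal z = 0
        rwa [Ideal.Quotient.eq_zero_iff_mem])
    exact ⟨_, key.comp _ (finSuccEquiv k).injective⟩

/-- The Krull dimension of a domain over a field is at most its transcendence degree. -/
theorem ringKrullDim_le_of_trdeg_le (K : Type*) {A : Type*} [Field K] [CommRing A] [IsDomain A]
    [Algebra K A] {n : ℕ} (h : Algebra.trdeg K A ≤ n) : ringKrullDim A ≤ n := by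
  refine iSup_le fun l => ?_
  obtain ⟨x, hx⟩ := exists_algebraicIndependent_of_ltSeries K l.length l rfl
  choose y hy using fun i => Ideal.Quotient.mk_surjective (x i)
  have hy' : AlgebraicIndependent K y := by
    refine AlgebraicIndependent.of_algHom_comp (Ideal.Quotient.mkₐ K l.head.asIdeal) ?_
    have h0 : Ideal.Quotient.mkₐ K l.head.asIdeal ∘ y = x := funext hy
    rw [h0]
    exact hx
  have h1 := hy'.lift_cardinalMk_le_trdeg
  have h2 := h1.trans (Cardinal.lift_le.2 h)
  simp only [Cardinal.mk_fin, Cardinal.lift_natCast, Nat.cast_le] at h2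
  exact_mod_cast h2

end TranscendenceDegree

/-! ### Dimension of monoid algebras -/

section MonoidAlgebra

variable (K : Type*) [Field K] (G : Type*) [AddCommGroup G] [Module.Free ℤ G] [Module.Finite ℤ G]

/-- Unique sums rule out zero divisors in the group algebra. -/
instance uniqueSums_of_free : UniqueSums G := by
  have e := (Module.finBasis ℤ G).equivFun.toAddEquiv
  exact UniqueSums.of_injective_addHom e.toAddHom e.injective inferInstance

/-- The exponents whose characters are algebraic over the subalgebra generated by the characters of
a basis form a subgroup, since algebraic elements are closed under products and inverses. It
contains the basis, so the algebra is algebraic over a subalgebra with at most `rank G` generators.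
-/
theorem trdeg_addMonoidAlgebra_le : Algebra.trdeg K (AddMonoidAlgebra K G) ≤ Module.finrank ℤ G := by
  let b := Module.finBasis ℤ G
  let s : Set (AddMonoidAlgebra K G) := Set.range fun i => AddMonoidAlgebra.single (b i) (1 : K)
  let R := Algebra.adjoin K s
  have hneg : ∀ m : G, IsAlgebraic R (AddMonoidAlgebra.single m (1 : K)) →
      IsAlgebraic R (AddMonoidAlgebra.single (-m) (1 : K)) := by
    intro m hm
    let _ : Invertible (AddMonoidAlgebra.single m (1 : K)) :=
      ⟨AddMonoidAlgebra.single (-m) 1,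
        by rw [AddMonoidAlgebra.single_mul_single, AddMonoidAlgebra.one_def]; simp,
        by rw [AddMonoidAlgebra.single_mul_single, AddMonoidAlgebra.one_def]; simp⟩
    exact hm.invOf
  have hadd : ∀ m m' : G, IsAlgebraic R (AddMonoidAlgebra.single m (1 : K)) →
      IsAlgebraic R (AddMonoidAlgebra.single m' (1 : K)) →
      IsAlgebraic R (AddMonoidAlgebra.single (m + m') (1 : K)) := by
    intro m m' h h'
    have := h.mul h'
    rwa [AddMonoidAlgebra.single_mul_single, mul_one] at this
  let S : AddSubgroup G :=
    { carrier := {m | IsAlgebraic R (AddMonoidAlgebra.single m (1 : K))}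
      zero_mem' := isAlgebraic_one
      add_mem' := fun {m m'} => hadd m m'
      neg_mem' := fun {m} => hneg m }
  have hS : ∀ m : G, IsAlgebraic R (AddMonoidAlgebra.single m (1 : K)) := by
    intro m
    have h1 : Submodule.span ℤ (Set.range b) ≤ AddSubgroup.toIntSubmodule S := by
      rw [Submodule.span_le]
      rintro _ ⟨i, rfl⟩
      exact isAlgebraic_algebraMap (⟨_, Algebra.subset_adjoin ⟨i, rfl⟩⟩ : R)
    rw [b.span_eq] at h1
    exact h1 (Submodule.mem_top (x := m))
  have : Algebra.IsAlgebraic R (AddMonoidAlgebra K G) := by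
    constructor
    intro f
    induction f using AddMonoidAlgebra.induction_linear with
    | zero => exact isAlgebraic_zero
    | add f g hf hg => exact hf.add hg
    | single m c =>
      have := (isAlgebraic_algebraMap (algebraMap K R c)).mul (hS m)
      have h1 : algebraMap R (AddMonoidAlgebra K G) (algebraMap K R c) *
          AddMonoidAlgebra.single m 1 = AddMonoidAlgebra.single m c := by
        rw [← IsScalarTower.algebraMap_apply, ← Algebra.smul_def, AddMonoidAlgebra.smul_single,
          smul_eq_mul, mul_one]
      rwa [h1] at this
  have h1 := Algebra.IsAlgebraic.trdeg_le_cardinalMk K s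
  have h2 := Cardinal.mk_range_le_lift (f := fun i => AddMonoidAlgebra.single (b i) (1 : K))
  simp only [Cardinal.mk_fin, Cardinal.lift_natCast, Cardinal.lift_le_nat_iff] at h2
  exact h1.trans h2

theorem ringKrullDim_addMonoidAlgebra_le :
    ringKrullDim (AddMonoidAlgebra K G) ≤ Module.finrank ℤ G :=
  ringKrullDim_le_of_trdeg_le K (trdeg_addMonoidAlgebra_le K G)

/-- Setting the first torus coordinate to `1` is a surjection onto the algebra of the smaller torus
which kills a nonzero element of a domain, so each coordinate contributes at least one dimension. -/
theorem le_ringKrullDim_addMonoidAlgebra_fin (n : ℕ) :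
    (n : WithBot ℕ∞) ≤ ringKrullDim (AddMonoidAlgebra K (Fin n → ℤ)) := by
  induction n with
  | zero => exact ringKrullDim_nonneg_of_nontrivial
  | succ n ih =>
    let t : Fin (n + 1) → ℤ := Pi.single 0 1
    let p : (Fin (n + 1) → ℤ) →+ (Fin n → ℤ) :=
      { toFun := Fin.tail, map_zero' := rfl, map_add' := fun _ _ => rfl }
    have hp : Function.Surjective p := fun x =>
      ⟨Fin.cons (α := fun _ => ℤ) 0 x, Fin.tail_cons (α := fun _ => ℤ) 0 x⟩
    let f := AddMonoidAlgebra.mapDomainAlgHom K K p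
    have hf : Function.Surjective f := by
      intro y
      induction y using AddMonoidAlgebra.induction_linear with
      | zero => exact ⟨0, map_zero f⟩
      | add y z hy hz =>
        obtain ⟨⟨y', rfl⟩, ⟨z', rfl⟩⟩ := And.intro hy hz
        exact ⟨y' + z', map_add f _ _⟩
      | single m c =>
        obtain ⟨m', rfl⟩ := hp m
        exact ⟨AddMonoidAlgebra.single m' c, AddMonoidAlgebra.mapDomain_single⟩
    have hr : AddMonoidAlgebra.single t (1 : K) - 1 ≠ 0 := by
      rw [sub_ne_zero, AddMonoidAlgebra.one_def]
      intro h
      have := (AddMonoidAlgebra.single_left_injective one_ne_zero).eq_iff.1 h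
      simpa [t] using congrFun this 0
    have h0 : f (AddMonoidAlgebra.single t (1 : K) - 1) = 0 := by
      rw [map_sub, map_one, sub_eq_zero, AddMonoidAlgebra.one_def]
      refine AddMonoidAlgebra.mapDomain_single.trans ?_
      congr 1
    have := ringKrullDim_succ_le_of_surjective f.toRingHom hf (mem_nonZeroDivisors_of_ne_zero hr) h0
    push_cast
    exact (add_le_add_left ih 1).trans this

/-- The dimension of the algebra of a lattice is the rank of the lattice. -/
theorem ringKrullDim_addMonoidAlgebra :
    ringKrullDim (AddMonoidAlgebra K G) = Module.finrank ℤ G := by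
  refine (ringKrullDim_addMonoidAlgebra_le K G).antisymm ?_
  have e := AddMonoidAlgebra.domCongr K K (Module.finBasis ℤ G).equivFun.toAddEquiv
  rw [ringKrullDim_eq_of_ringEquiv e.toRingEquiv]
  exact le_ringKrullDim_addMonoidAlgebra_fin K _

theorem isDomain_addSubmonoidAlgebra (S : AddSubmonoid G) : IsDomain (AddMonoidAlgebra K S) :=
  (AddMonoidAlgebra.mapDomain_injective (f := S.subtype) Subtype.val_injective).isDomain
    (AddMonoidAlgebra.mapDomainAlgHom K K S.subtype).toRingHom

/-- The algebra of a submonoid of a lattice has dimension at most the rank of the lattice. -/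
theorem ringKrullDim_addSubmonoidAlgebra_le (S : AddSubmonoid G) :
    ringKrullDim (AddMonoidAlgebra K S) ≤ Module.finrank ℤ G := by
  let f : AddMonoidAlgebra K S →ₐ[K] AddMonoidAlgebra K G :=
    AddMonoidAlgebra.mapDomainAlgHom K K S.subtype
  have hf : Function.Injective f := AddMonoidAlgebra.mapDomain_injective Subtype.val_injective
  have := isDomain_addSubmonoidAlgebra K G S
  exact ringKrullDim_le_of_trdeg_le K
    ((trdeg_le_of_injective f hf).trans (trdeg_addMonoidAlgebra_le K G))

end MonoidAlgebra

/-! ### Dimension of schemes -/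

section Dimension

/-- The dimension of a space is bounded by the dimensions of the members of an open cover. -/
theorem topologicalKrullDim_le_of_openCover {X : Type*} [TopologicalSpace X] {n : WithBot ℕ∞}
    (h : ∀ x : X, ∃ (U : Type u) (_ : TopologicalSpace U) (f : U → X),
      Topology.IsOpenEmbedding f ∧ x ∈ Set.range f ∧ topologicalKrullDim U ≤ n) :
    topologicalKrullDim X ≤ n := by
  rw [topologicalKrullDim, Order.krullDim_eq_iSup_coheight]
  -- The coheight of `Z` counts chains of irreducible closed sets above `Z`. These all meet any open
  -- set that meets `Z`, so the coheight can be computed in a chart around a point of `Z`.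
  refine iSup_le fun Z => ?_
  obtain ⟨z, hz⟩ := Z.isIrreducible.nonempty
  obtain ⟨U, _, f, hf, ⟨u, rfl⟩, hU⟩ := h z
  have hne : (f ⁻¹' Z).Nonempty := ⟨u, hz⟩
  let e := TopologicalSpace.IrreducibleCloseds.orderIsoOfIsOpenEmbedding f hf
  have hW : TopologicalSpace.IrreducibleCloseds.map f hf.continuous (e.symm ⟨Z, hne⟩) = Z :=
    congrArg Subtype.val (e.apply_symm_apply ⟨Z, hne⟩)
  rw [← hW, hf.coheight_map]
  exact (Order.coheight_le_krullDim _).trans hU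

/-- Truncated subtraction is harmless: for `n = 0` the hypothesis forces `x = ⊥`. -/
theorem le_natCast_sub_one {x : WithBot ℕ∞} {n : ℕ} (h : x + 1 ≤ n) :
    x ≤ ((n - 1 : ℕ) : WithBot ℕ∞) := by
  induction x using WithBot.recBotCoe with
  | bot => exact bot_le
  | coe x =>
    induction x using ENat.recTopCoe with
    | top =>
      have h1 : (⊤ : ℕ∞) + 1 ≤ (n : ℕ∞) := WithBot.coe_le_coe.1 h
      simp at h1
    | coe x =>
      have h1 : (x : ℕ∞) + 1 ≤ (n : ℕ∞) := WithBot.coe_le_coe.1 h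
      have h2 : x + 1 ≤ n := by exact_mod_cast h1
      exact WithBot.coe_le_coe.2 (Nat.cast_le.2 (Nat.le_sub_one_of_lt h2))

theorem topologicalKrullDim_nonneg (X : Type*) [TopologicalSpace X] [Nonempty X] :
    0 ≤ topologicalKrullDim X := by
  have : Nonempty (TopologicalSpace.IrreducibleCloseds X) :=
    ⟨⟨closure {Classical.arbitrary X}, isIrreducible_singleton.closure, isClosed_closure⟩⟩
  exact Order.krullDim_nonneg

theorem topologicalKrullDim_Spec (R : CommRingCat) :
    topologicalKrullDim (Spec R) = ringKrullDim R :=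
  PrimeSpectrum.topologicalKrullDim_eq_ringKrullDim R

end Dimension

/-! ### The real space of a lattice -/

namespace Toric

section Lattice

variable {M : Type u} [AddCommGroup M] [Module.Free ℤ M] [Module.Finite ℤ M]

theorem finrank_nreal : Module.finrank ℝ (NReal M) = Module.finrank ℤ M := by
  let b := Module.finBasis ℤ M
  rw [← (b.constr (M' := ℝ) ℝ).finrank_eq, Module.finrank_fin_fun]

theorem span_range_latticeToReal :
    Submodule.span ℝ (Set.range (latticeToReal (M := M))) = ⊤ := by
  rw [eq_top_iff]
  intro x _
  let b := Module.finBasis ℤ M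
  have hx : x = ∑ i, x (b i) • latticeToReal (b.coord i) := by
    refine b.ext fun j => ?_
    simp [latticeToReal, Finsupp.single_apply]
  rw [hx]
  exact Submodule.sum_mem _ fun i _ => Submodule.smul_mem _ _ (Submodule.subset_span ⟨_, rfl⟩)

end Lattice

end Toric

/-! ### The lattice of the Lawrence toric variety -/

namespace Arrangement

variable {E N : Type u} [AddCommGroup N] {A : Arrangement E N}

/-- A maximal independent subfamily of the `a_e` spans a sublattice of finite index. -/
theorem IsPrimitiveSpanning.eq_zero_of_span_image {V : Type*} [AddCommGroup V]
    [Module.IsTorsionFree ℤ V] (hA : A.IsPrimitiveSpanning) {I : Set E}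
    (hI : ∀ e ∉ I, ∃ k : ℤ, k ≠ 0 ∧ k • A.a e ∈ Submodule.span ℤ (A.a '' I))
    (φ : N →ₗ[ℤ] V) (hφ : ∀ e ∈ I, φ (A.a e) = 0) : φ = 0 := by
  have h1 : Submodule.span ℤ (A.a '' I) ≤ LinearMap.ker φ := by
    rw [Submodule.span_le]
    rintro _ ⟨e, he, rfl⟩
    exact hφ e he
  have h2 : Submodule.span ℤ (Set.range A.a) ≤ LinearMap.ker φ := by
    rw [Submodule.span_le]
    rintro _ ⟨e, rfl⟩
    by_cases he : e ∈ I
    · exact hφ e he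
    · obtain ⟨k, hk, h⟩ := hI e he
      have h3 : φ (k • A.a e) = 0 := h1 h
      rw [map_smul, smul_eq_zero] at h3
      exact h3.resolve_left hk
  rw [hA.spanning] at h2
  ext n
  exact h2 (Submodule.mem_top (x := n))

/-- The sign at `e` is zero exactly on `H_e`, so the face of `ξ` is contained in every hyperplane
through `ξ`. If these meet only in `ξ`, the face is a point. -/
theorem isVertex_of_forall {ξ : MReal N}
    (h : ∀ m : MReal N, (∀ e, ξ (A.a e) + A.r e = 0 → m (A.a e) + A.r e = 0) → m = ξ) :
    A.IsVertex ξ := by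
  refine ⟨ξ, Set.ext fun m => ⟨?_, fun hm => h m fun e he => ?_⟩⟩
  · rintro rfl
    rfl
  · have := congrFun hm e
    rw [sgn, sgn, he, neg_zero, sign_zero, sign_eq_zero_iff, neg_eq_zero] at this
    exact this

/-- An arrangement with spanning normal vectors has a vertex. -/
theorem IsPrimitiveSpanning.exists_vertex (hA : A.IsPrimitiveSpanning) :
    ∃ (I : Set E) (ξ : MReal N),
      (∀ e ∉ I, ∃ k : ℤ, k ≠ 0 ∧ k • A.a e ∈ Submodule.span ℤ (A.a '' I)) ∧
      (∀ e ∈ I, ξ (A.a e) + A.r e = 0) ∧ A.IsVertex ξ := by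
  obtain ⟨I, hI, hmax⟩ := exists_maximal_linearIndepOn ℤ A.a
  let b := Module.Basis.span hI
  have hinj := Subtype.val_injective (p := (· ∈ Submodule.span ℤ (Set.range fun e : I => A.a e)))
  -- On the span of the independent `a_e`, `e ∈ I`, the values `-r_e` can be prescribed freely. The
  -- span need not be all of `N`, but `ℝ` is divisible, hence injective over `ℤ`, and the functional
  -- extends.
  obtain ⟨ξ, hξ⟩ := (Module.Baer.of_divisible ℝ).extension_property
    (Submodule.span ℤ (Set.range fun e : I => A.a e)).subtype hinj
    (b.constr ℤ fun e : I => (-(A.r e : ℝ)))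
  have h0 : ∀ e ∈ I, ξ (A.a e) + A.r e = 0 := by
    intro e he
    have h1 := LinearMap.congr_fun hξ (b ⟨e, he⟩)
    rw [Module.Basis.constr_basis] at h1
    have h2 : ((b ⟨e, he⟩ : Submodule.span ℤ (Set.range fun e : I => A.a e)) : N) = A.a e :=
      congrArg Subtype.val (Module.Basis.span_apply hI ⟨e, he⟩)
    rw [LinearMap.comp_apply, Submodule.subtype_apply, h2] at h1
    rw [h1, neg_add_cancel]
  refine ⟨I, ξ, hmax, h0, isVertex_of_forall fun m hm => ?_⟩
  rw [← sub_eq_zero]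
  refine hA.eq_zero_of_span_image hmax _ fun e he => ?_
  have h1 := h0 e he
  have h2 := hm e h1
  rw [LinearMap.sub_apply]
  linarith

/-! ### Relations among the normal vectors, and the lattice `Ñ`. -/

variable [Fintype E]

theorem mem_relations {c : E → ℤ} : c ∈ A.relations ↔ ∑ e, c e • A.a e = 0 := by
  rw [relations, LinearMap.mem_ker, Fintype.linearCombination_apply]

theorem IsPrimitiveSpanning.linearCombination_surjective (hA : A.IsPrimitiveSpanning) :
    Function.Surjective (Fintype.linearCombination ℤ A.a) := by
  rw [← LinearMap.range_eq_top, Fintype.range_linearCombination, hA.spanning]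

/-- The map `(x, y) ↦ (x + y, ∑ x_e a_e)` is onto `ℤ^E ⊕ N` because the `a_e` generate `N`, and its
kernel is the antidiagonal copy of `Λ`. Hence `Ñ ≅ ℤ^E ⊕ N`. -/
theorem IsPrimitiveSpanning.free_nTilde [Module.Free ℤ N] (hA : A.IsPrimitiveSpanning) :
    Module.Free ℤ A.NTilde := by
  let f : (E → ℤ) × (E → ℤ) →ₗ[ℤ] (E → ℤ) × N :=
    LinearMap.prod (LinearMap.fst ℤ _ _ + LinearMap.snd ℤ _ _)
      (Fintype.linearCombination ℤ A.a ∘ₗ LinearMap.fst ℤ _ _)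
  have hf : Function.Surjective f := by
    rintro ⟨x, n⟩
    obtain ⟨y, rfl⟩ := hA.linearCombination_surjective n
    exact ⟨(y, x - y), Prod.ext (add_sub_cancel y x) rfl⟩
  have hker : A.relations.map (antidiag E) = LinearMap.ker f := by
    ext ⟨x, y⟩
    simp only [Submodule.mem_map, LinearMap.mem_ker]
    constructor
    · rintro ⟨c, hc, h⟩
      obtain ⟨rfl, rfl⟩ := Prod.ext_iff.1 h
      exact Prod.ext (add_neg_cancel c) hc
    · intro h
      obtain ⟨h1, h2⟩ := Prod.ext_iff.1 h
      exact ⟨x, h2, Prod.ext rfl (neg_eq_of_add_eq_zero_right h1)⟩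
  exact Module.Free.of_equiv
    ((Submodule.quotEquivOfEq _ _ hker).trans (f.quotKerEquivOfSurjective hf)).symm

/-- A nonzero integral relation may vanish modulo the characteristic of `K`. Divided by the gcd of
its coefficients it is still a relation, `N` being torsion-free, and the characteristic, which is
never `1`, cannot divide all the new coefficients. -/
theorem exists_relation_ne_zero (K : Type*) [Field K] [Module.IsTorsionFree ℤ N]
    (h : A.relations ≠ ⊥) : ∃ c ∈ A.relations, ∃ e, (c e : K) ≠ 0 := by
  obtain ⟨c, hc, hc0⟩ := Submodule.exists_mem_ne_zero_of_ne_bot h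
  obtain ⟨e₀, he₀⟩ := Function.ne_iff.1 hc0
  obtain ⟨g, hg, hg1⟩ := Finset.extract_gcd c (s := Finset.univ) ⟨e₀, Finset.mem_univ _⟩
  have hcg : c = (Finset.univ.gcd c) • g := funext fun e => hg e (Finset.mem_univ e)
  have hk : Finset.univ.gcd c ≠ 0 := fun h0 => hc0 (by rw [hcg, h0, zero_smul])
  refine ⟨g, ?_, ?_⟩
  · rw [hcg, relations, LinearMap.mem_ker, map_smul, smul_eq_zero] at hc
    exact hc.resolve_left hk
  · by_contra! hall
    have h1 : (ringChar K : ℤ) ∣ Finset.univ.gcd g :=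
      Finset.dvd_gcd fun e _ => (CharP.intCast_eq_zero_iff K (ringChar K) _).1 (hall e)
    rw [hg1] at h1
    have h2 : ringChar K ∣ 1 := by exact_mod_cast h1
    exact CharP.ringChar_ne_one (Nat.dvd_one.1 h2)

/-- The image of `Ñ` in its real space. -/
def tildeToReal (A : Arrangement E N) : A.NTilde →ₗ[ℤ] NReal A.MTilde where
  toFun n := latticeToReal (Module.Dual.eval ℤ A.NTilde n)
  map_add' x y := by ext; simp [latticeToReal]
  map_smul' c x := by ext; simp [latticeToReal]

/-- A finite free lattice is reflexive, so `Ñ` is the full lattice in its real space. -/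
theorem span_range_tildeToReal [Module.Free ℤ A.NTilde] :
    Submodule.span ℝ (Set.range A.tildeToReal) = ⊤ := by
  rw [← span_range_latticeToReal]
  congr 1
  have h : Function.Surjective (Module.Dual.eval ℤ A.NTilde) :=
    (Module.bijective_dual_eval ℤ A.NTilde).2
  exact h.range_comp latticeToReal

variable [DecidableEq E]

theorem mk_eq_sum (x y : E → ℤ) :
    (Submodule.Quotient.mk (x, y) : A.NTilde) = ∑ e, x e • A.rhoPos e + ∑ e, y e • A.rhoNeg e := by
  have h : (x, y) = ∑ e, x e • ((Pi.single e 1, 0) : (E → ℤ) × (E → ℤ)) +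
      ∑ e, y e • ((0, Pi.single e 1) : (E → ℤ) × (E → ℤ)) := by
    refine Prod.ext ?_ ?_
    · simp only [Prod.fst_add, Prod.fst_sum, Prod.smul_fst, smul_zero, Finset.sum_const_zero,
        add_zero]
      exact pi_eq_sum_univ' x
    · simp only [Prod.snd_add, Prod.snd_sum, Prod.smul_snd, smul_zero, Finset.sum_const_zero,
        zero_add]
      exact pi_eq_sum_univ' y
  change Submodule.mkQ _ _ = _
  rw [h, map_add, map_sum, map_sum]
  simp only [map_smul]
  rfl

theorem tildeToReal_mem_lawrenceCone {R : Set (MReal N)} {n : A.NTilde}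
    (hn : n ∈ A.coneGenerators R) : A.tildeToReal n ∈ A.lawrenceCone R :=
  Submodule.subset_span ⟨n, hn, rfl⟩

/-- The cone of a vertex has full dimension. -/
theorem IsPrimitiveSpanning.coneDim_lawrenceCone [Module.Free ℤ N] (hA : A.IsPrimitiveSpanning)
    {I : Set E} {ξ : MReal N}
    (hI : ∀ e ∉ I, ∃ k : ℤ, k ≠ 0 ∧ k • A.a e ∈ Submodule.span ℤ (A.a '' I))
    (hξ : ∀ e ∈ I, ξ (A.a e) + A.r e = 0) :
    coneDim (A.lawrenceCone {ξ}) = Module.finrank ℤ A.MTilde := by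
  have := hA.free_nTilde
  let W := Submodule.span ℝ (A.lawrenceCone {ξ} : Set (NReal A.MTilde))
  have hpos : ∀ e, ξ (A.a e) + A.r e ≤ 0 → A.tildeToReal (A.rhoPos e) ∈ W := fun e he =>
    Submodule.subset_span (tildeToReal_mem_lawrenceCone ⟨e, Or.inl ⟨Set.singleton_subset_iff.2 he, rfl⟩⟩)
  have hneg : ∀ e, 0 ≤ ξ (A.a e) + A.r e → A.tildeToReal (A.rhoNeg e) ∈ W := fun e he =>
    Submodule.subset_span (tildeToReal_mem_lawrenceCone ⟨e, Or.inr ⟨Set.singleton_subset_iff.2 he, rfl⟩⟩)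
  -- This map sends `δ_e` to `ρ_e^+ - ρ_e^-` and kills `Λ`. One of `ρ_e^±` always lies in the cone,
  -- so it suffices that all these differences lie in `W`.
  let g : (E → ℤ) →ₗ[ℤ] NReal A.MTilde :=
    A.tildeToReal ∘ₗ Submodule.mkQ _ ∘ₗ antidiag E
  have hg : ∀ e, g (Pi.single e 1) = A.tildeToReal (A.rhoPos e) - A.tildeToReal (A.rhoNeg e) := by
    intro e
    rw [← map_sub]
    change A.tildeToReal (Submodule.Quotient.mk (Pi.single e 1, -Pi.single e 1)) = _
    rw [rhoPos, rhoNeg, ← Submodule.Quotient.mk_sub, Prod.mk_sub_mk, sub_zero, zero_sub]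
  have hdiff : ∀ e, g (Pi.single e 1) ∈ W := by
    intro e
    by_cases he : e ∈ I
    · rw [hg]
      exact sub_mem (hpos e (hξ e he).le) (hneg e (hξ e he).ge)
    -- Modulo `Λ`, the vector `k δ_e` is a combination `y` of the `δ_f` with `f ∈ I`. For those, `ξ
    -- ∈ H_f` puts both `ρ_f^±` in the cone. Dividing by `k` is allowed in the real space `W`.
    · obtain ⟨k, hk, h⟩ := hI e he
      have himg : A.a '' I = Fintype.linearCombination ℤ A.a '' ((fun f => Pi.single f 1) '' I) := by
        rw [Set.image_image]
        simp
      rw [himg, ← Submodule.map_span] at h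
      obtain ⟨y, hy, hyk⟩ := h
      have h1 : g (k • Pi.single e 1 - y) = 0 := by
        have h2 : k • Pi.single e 1 - y ∈ A.relations := by
          rw [relations, LinearMap.mem_ker, map_sub, hyk, map_smul]
          simp
        have h3 : (Submodule.mkQ (A.relations.map (antidiag E)))
            (antidiag E (k • Pi.single e 1 - y)) = 0 :=
          (Submodule.Quotient.mk_eq_zero _).2 ⟨_, h2, rfl⟩
        rw [LinearMap.comp_apply, LinearMap.comp_apply, h3, map_zero]
      have h2 : g y ∈ W := by
        have : Submodule.span ℤ ((fun f : E => (Pi.single f 1 : E → ℤ)) '' I) ≤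
            (W.restrictScalars ℤ).comap g := by
          rw [Submodule.span_le]
          rintro _ ⟨f, hf, rfl⟩
          change g _ ∈ W
          rw [hg]
          exact sub_mem (hpos f (hξ f hf).le) (hneg f (hξ f hf).ge)
        exact this hy
      rw [map_sub, map_smul, sub_eq_zero] at h1
      rw [← h1] at h2
      have h3 : g (Pi.single e 1) = (k : ℝ)⁻¹ • (k • g (Pi.single e 1)) := by
        rw [← Int.cast_smul_eq_zsmul ℝ, smul_smul, inv_mul_cancel₀ (by exact_mod_cast hk), one_smul]
      rw [h3]
      exact W.smul_mem _ h2
  have hpos' : ∀ e, A.tildeToReal (A.rhoPos e) ∈ W := by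
    intro e
    rcases le_total (ξ (A.a e) + A.r e) 0 with h | h
    · exact hpos e h
    · have := add_mem (hdiff e) (hneg e h)
      rwa [hg, sub_add_cancel] at this
  have hneg' : ∀ e, A.tildeToReal (A.rhoNeg e) ∈ W := by
    intro e
    have := sub_mem (hpos' e) (hdiff e)
    rwa [hg, sub_sub_cancel] at this
  have hW : W = ⊤ := by
    rw [eq_top_iff, ← span_range_tildeToReal, Submodule.span_le]
    rintro _ ⟨n, rfl⟩
    obtain ⟨⟨x, y⟩, rfl⟩ := Submodule.Quotient.mk_surjective _ n
    rw [mk_eq_sum, map_add, map_sum, map_sum]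
    refine add_mem (sum_mem fun e _ => ?_) (sum_mem fun e _ => ?_)
    · rw [map_smul]
      exact (W.restrictScalars ℤ).smul_mem _ (hpos' e)
    · rw [map_smul]
      exact (W.restrictScalars ℤ).smul_mem _ (hneg' e)
  change Module.finrank ℝ W = _
  rw [hW, finrank_top, finrank_nreal]

end Arrangement

/-! ### Closed subschemes of affine schemes -/

theorem Spec_map_comp_eq {A B C D : Type u} [CommRing A] [CommRing B] [CommRing C] [CommRing D]
    {f : B →+* A} {g : D →+* B} {h : C →+* A} {k : D →+* C} (H : f.comp g = h.comp k) :
    Spec.map (CommRingCat.ofHom f) ≫ Spec.map (CommRingCat.ofHom g) =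
      Spec.map (CommRingCat.ofHom h) ≫ Spec.map (CommRingCat.ofHom k) := by
  rw [← Spec.map_comp, ← Spec.map_comp, ← CommRingCat.ofHom_comp, ← CommRingCat.ofHom_comp, H]

/-- The inverse image in `Spec R` of a closed subscheme of `Spec P` is smaller than `Spec R` if an
equation of the subscheme does not vanish identically on `Spec R`. -/
theorem topologicalKrullDim_pullback_add_one_le {P R : Type u} [CommRing P] [CommRing R]
    [IsDomain R] (φ : P →+* R) (L : Ideal P) {p : P} (hp : p ∈ L) (hφ : φ p ≠ 0) :
    topologicalKrullDim ↥(pullback (Spec.map (CommRingCat.ofHom φ))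
      (Spec.map (CommRingCat.ofHom (Ideal.Quotient.mk L)))) + 1 ≤ ringKrullDim R := by
  have : IsClosedImmersion (Spec.map (CommRingCat.ofHom (Ideal.Quotient.mk L))) :=
    IsClosedImmersion.spec_of_surjective _ Ideal.Quotient.mk_surjective
  have hclosed : IsClosedImmersion (pullback.fst (Spec.map (CommRingCat.ofHom φ))
    (Spec.map (CommRingCat.ofHom (Ideal.Quotient.mk L)))) := inferInstance
  -- The fibre product is `Spec (R ⧸ I)` for some ideal `I`, which need not be identified. The
  -- second projection gives a ring map `P ⧸ L → R ⧸ I`, and this already shows `φ p ∈ I`.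
  obtain ⟨I, i, hi⟩ := IsClosedImmersion.Spec_iff.1 hclosed
  have hcond := pullback.condition (f := Spec.map (CommRingCat.ofHom φ))
    (g := Spec.map (CommRingCat.ofHom (Ideal.Quotient.mk L)))
  obtain ⟨ψ, hψ⟩ := Spec.map_surjective (i.inv ≫ pullback.snd (Spec.map (CommRingCat.ofHom φ))
    (Spec.map (CommRingCat.ofHom (Ideal.Quotient.mk L))))
  have h1 : Spec.map (CommRingCat.ofHom (Ideal.Quotient.mk I)) ≫ Spec.map (CommRingCat.ofHom φ) =
      Spec.map ψ ≫ Spec.map (CommRingCat.ofHom (Ideal.Quotient.mk L)) := by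
    rw [hψ, Category.assoc, ← hcond, hi, Category.assoc, i.inv_hom_id_assoc]
  rw [← Spec.map_comp, ← Spec.map_comp] at h1
  have h2 : Ideal.Quotient.mk I (φ p) = ψ.hom (Ideal.Quotient.mk L p) :=
    congrArg (fun f => f.hom p) (Spec.map_injective h1)
  rw [Ideal.Quotient.eq_zero_iff_mem.2 hp, map_zero] at h2
  rw [(Scheme.homeoOfIso i).isHomeomorph.topologicalKrullDim_eq, topologicalKrullDim_Spec]
  exact ringKrullDim_succ_le_of_surjective (Ideal.Quotient.mk I) Ideal.Quotient.mk_surjective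
    (mem_nonZeroDivisors_of_ne_zero hφ) h2

/-! ### Charts of toric varieties -/

namespace Toric.ConeSystem

variable {M : Type u} [AddCommGroup M] (Δ : ConeSystem M) (K : Type u) [Field K]

instance : Quiver.IsThin Δ.Cone := fun _ _ => inferInstance

instance (σ : Δ.Cone) : IsOpenImmersion (Δ.chart K σ) :=
  inferInstanceAs (IsOpenImmersion (colimit.ι (Δ.diagram K) σ))

theorem chart_jointly_surjective (x : Δ.toricVariety K) : ∃ σ y, Δ.chart K σ y = x :=
  Scheme.IsLocallyDirected.ι_jointly_surjective (Δ.diagram K) x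

theorem chart_toAffineSpace {E : Type u} (v : E → M)
    (hv : ∀ σ ∈ Δ.cones, ∀ e, v e ∈ dualMonoid σ) (σ : Δ.Cone) :
    Δ.chart K σ ≫ Δ.toAffineSpace K v hv = Spec.map (CommRingCat.ofHom
      (MvPolynomial.aeval (R := K) (fun e => chi K (σ := σ.cone) ⟨v e, hv _ σ.mem e⟩)).toRingHom) :=
  colimit.ι_desc _ _

theorem chart_toSpecField (σ : Δ.Cone) : Δ.chart K σ ≫ Δ.toSpecField K =
    Spec.map (CommRingCat.ofHom (algebraMap K (CoordRing K σ.cone))) :=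
  colimit.ι_desc _ _

end Toric.ConeSystem

namespace Arrangement

variable {E N : Type u} [AddCommGroup N] {A : Arrangement E N} [Fintype E]
  {K : Type u} [Field K]

/-- The linear form of a relation. -/
noncomputable def linearForm (K : Type u) [Field K] (c : E → ℤ) : MvPolynomial E K :=
  ∑ e, MvPolynomial.C (c e : K) * MvPolynomial.X e

theorem linearForm_mem {c : E → ℤ} (hc : c ∈ A.relations) : linearForm K c ∈ A.linearIdeal K :=
  Ideal.subset_span ⟨c, hc, rfl⟩

variable [DecidableEq E]

/-- The pull-back of functions along `Φ`, on the chart of a cone. -/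
noncomputable def chartHom (K : Type u) [Field K] (σ : A.lawrenceFan.Cone) :
    MvPolynomial E K →ₐ[K] CoordRing K σ.cone :=
  MvPolynomial.aeval (R := K)
    (fun e => chi K (σ := σ.cone) ⟨A.coordChar e, A.coordChar_mem _ σ.mem e⟩)

theorem chartHom_X (σ : A.lawrenceFan.Cone) (e : E) : chartHom K σ (MvPolynomial.X e) =
    AddMonoidAlgebra.single ⟨A.coordChar e, A.coordChar_mem _ σ.mem e⟩ 1 :=
  MvPolynomial.aeval_X _ _

/-- The chart of a cone of the Lawrence fan. -/
noncomputable def lawrenceChart (A : Arrangement E N) (K : Type u) [Field K]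
    (σ : A.lawrenceFan.Cone) : affineToric K σ.cone ⟶ A.lawrenceVariety K :=
  A.lawrenceFan.chart K σ

instance (σ : A.lawrenceFan.Cone) : IsOpenImmersion (A.lawrenceChart K σ) :=
  inferInstanceAs (IsOpenImmersion (A.lawrenceFan.chart K σ))

/-- The torus orbit of a cone of the Lawrence fan. -/
noncomputable def lawrenceOrbit (A : Arrangement E N) (K : Type u) [Field K]
    (σ : A.lawrenceFan.Cone) : torusOrbit K σ.cone ⟶ A.lawrenceVariety K :=
  Spec.map (CommRingCat.ofHom (orbitHom K σ.cone).toRingHom) ≫ A.lawrenceChart K σ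

theorem orbitInter_eq (σ : A.lawrenceFan.Cone) :
    A.lawrenceFan.orbitInter K (A.lawrenceEmbedding K) σ =
      pullback (A.lawrenceEmbedding K) (A.lawrenceOrbit K σ) := rfl

theorem chart_lawrenceToAffine (σ : A.lawrenceFan.Cone) :
    A.lawrenceChart K σ ≫ A.lawrenceToAffine K =
      Spec.map (CommRingCat.ofHom (chartHom K σ).toRingHom) :=
  A.lawrenceFan.chart_toAffineSpace K _ A.coordChar_mem σ

theorem coordChar_rhoPos (e f : E) :
    A.coordChar e (A.rhoPos f) = (Pi.single f 1 : E → ℤ) e := by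
  simp [coordChar, sumMap, rhoPos]

theorem coordChar_rhoNeg (e f : E) :
    A.coordChar e (A.rhoNeg f) = (Pi.single f 1 : E → ℤ) e := by
  simp [coordChar, sumMap, rhoNeg]

theorem coordChar_injective : Function.Injective A.coordChar := by
  intro e f h
  by_contra hef
  have := LinearMap.congr_fun h (A.rhoPos f)
  rw [coordChar_rhoPos, coordChar_rhoPos, Pi.single_eq_same, Pi.single_eq_of_ne hef] at this
  exact zero_ne_one this

/-- The linear form becomes a combination of pairwise distinct characters, so its coefficients can
be read off. -/
theorem chartHom_linearForm_ne_zero (σ : A.lawrenceFan.Cone) {c : E → ℤ} {e : E}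
    (he : (c e : K) ≠ 0) : chartHom K σ (linearForm K c) ≠ 0 := by
  intro h
  have h1 : chartHom K σ (linearForm K c) = ∑ f, AddMonoidAlgebra.single
      (⟨A.coordChar f, A.coordChar_mem _ σ.mem f⟩ : dualMonoid σ.cone) (c f : K) := by
    rw [linearForm, map_sum]
    refine Finset.sum_congr rfl fun f _ => ?_
    rw [map_mul, chartHom_X, MvPolynomial.C_eq_smul_one, map_smul, map_one, smul_one_mul,
      AddMonoidAlgebra.smul_single, smul_eq_mul, mul_one]
  rw [h1] at h
  have h2 := DFunLike.congr_fun (congrArg AddMonoidAlgebra.coeff h)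
    (⟨A.coordChar e, A.coordChar_mem _ σ.mem e⟩ : dualMonoid σ.cone)
  rw [AddMonoidAlgebra.coeff_sum, Finsupp.finsetSum_apply, Finset.sum_eq_single e] at h2
  · simp at h2
    exact he h2
  · intro f _ hf
    simp [coordChar_injective.eq_iff, hf]
  · simp

/-! ### Dimension of the hypertoric variety -/

/-- A nonzero relation makes the hypertoric variety smaller than the Lawrence toric variety. -/
theorem topologicalKrullDim_hypertoric_le [Module.Free ℤ A.MTilde] [Module.Finite ℤ A.MTilde]
    {c : E → ℤ} (hc : c ∈ A.relations) {e : E} (he : (c e : K) ≠ 0) :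
    topologicalKrullDim (A.hypertoric K) ≤ ((Module.finrank ℤ A.MTilde - 1 : ℕ) : WithBot ℕ∞) := by
  refine topologicalKrullDim_le_of_openCover.{u} fun x => ?_
  obtain ⟨σ, y, hy⟩ : ∃ σ y, A.lawrenceChart K σ y = A.lawrenceEmbedding K x :=
    A.lawrenceFan.chart_jointly_surjective K (A.lawrenceEmbedding K x)
  obtain ⟨z, -, hz⟩ := Scheme.Pullback.exists_preimage_pullback (f := A.lawrenceChart K σ)
    (g := A.lawrenceEmbedding K) y x hy
  let q := pullback.snd (A.lawrenceChart K σ) (A.lawrenceEmbedding K)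
  refine ⟨_, inferInstance, q, q.isOpenEmbedding, ⟨z, hz⟩, ?_⟩
  -- By pasting of pullbacks, the part of the hypertoric variety in a chart is the preimage of the
  -- linear subspace under the restriction of `Φ`, a morphism of affine schemes.
  have j : pullback (A.lawrenceChart K σ) (A.lawrenceEmbedding K) ≅
      pullback (A.lawrenceChart K σ ≫ A.lawrenceToAffine K) (A.linearSpaceMap K) :=
    pullbackRightPullbackFstIso _ _ _
  rw [(Scheme.homeoOfIso j).isHomeomorph.topologicalKrullDim_eq, chart_lawrenceToAffine]
  have := isDomain_addSubmonoidAlgebra K A.MTilde (dualMonoid σ.cone)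
  exact le_natCast_sub_one ((topologicalKrullDim_pullback_add_one_le _ _ (linearForm_mem hc)
    (chartHom_linearForm_ne_zero σ he)).trans (ringKrullDim_addSubmonoidAlgebra_le K A.MTilde _))

/-! ### The orbit of the cone of a vertex -/

/-- The point `ξ` lies in `H_e^+` or `H_e^-`, so `ρ_e^+` or `ρ_e^-` is in the cone, and the `e`-th
coordinate is `1` on both. -/
theorem coordChar_notMem_perpLattice (ξ : MReal N) (e : E) :
    A.coordChar e ∉ perpLattice (A.lawrenceCone {ξ}) := by
  have key : ∀ n, n ∈ A.coneGenerators {ξ} → A.coordChar e n = 1 →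
      A.coordChar e ∉ perpLattice (A.lawrenceCone {ξ}) := by
    intro n hn h1 h
    have h2 : ((A.coordChar e n : ℤ) : ℝ) = 0 := h _ (tildeToReal_mem_lawrenceCone hn)
    rw [h1, Int.cast_one] at h2
    exact one_ne_zero h2
  rcases le_total (ξ (A.a e) + A.r e) 0 with h | h
  · exact key _ ⟨e, Or.inl ⟨Set.singleton_subset_iff.2 h, rfl⟩⟩
      (by rw [coordChar_rhoPos, Pi.single_eq_same])
  · exact key _ ⟨e, Or.inr ⟨Set.singleton_subset_iff.2 h, rfl⟩⟩
      (by rw [coordChar_rhoNeg, Pi.single_eq_same])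

/-- The hypertoric variety contains the torus orbits which `Φ` maps to the origin. -/
theorem meets_of_forall_notMem (σ : A.lawrenceFan.Cone)
    (hσ : ∀ e, A.coordChar e ∉ perpLattice σ.cone) : A.Meets K σ := by
  -- The augmentation is the identity point of the torus `O(σ)`. It is paired with the origin of the
  -- linear subspace to give a point of the fibre product.
  let ε : AddMonoidAlgebra K (perpLattice σ.cone) →ₐ[K] K :=
    AddMonoidAlgebra.lift K K (perpLattice σ.cone) 1
  have hL : ∀ p ∈ A.linearIdeal K, (MvPolynomial.aeval (R := K) (fun _ : E => (0 : K))) p = 0 := by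
    intro p hp
    have : A.linearIdeal K ≤ RingHom.ker (MvPolynomial.aeval (R := K) (fun _ : E => (0 : K))) := by
      refine Ideal.span_le.2 ?_
      rintro _ ⟨c, -, rfl⟩
      simp [RingHom.mem_ker]
    exact this hp
  let δ : MvPolynomial E K ⧸ A.linearIdeal K →+* K :=
    Ideal.Quotient.lift _ (MvPolynomial.aeval (R := K) (fun _ : E => (0 : K))).toRingHom hL
  let x : Spec (CommRingCat.of K) ⟶ torusOrbit K σ.cone :=
    Spec.map (CommRingCat.ofHom ε.toRingHom)
  let y : Spec (CommRingCat.of K) ⟶ A.linearSpace K := Spec.map (CommRingCat.ofHom δ)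
  have hring : (ε.comp (orbitHom K σ.cone)).comp (chartHom K σ) =
      MvPolynomial.aeval (R := K) (fun _ : E => (0 : K)) := by
    refine MvPolynomial.algHom_ext fun e => ?_
    rw [AlgHom.comp_apply, chartHom_X, AlgHom.comp_apply, MvPolynomial.aeval_X, orbitHom,
      AddMonoidAlgebra.lift_single]
    refine (congrArg (fun z => ε ((1 : K) • z)) (dif_neg (hσ e))).trans ?_
    rw [smul_zero, map_zero]
  have hxy : (x ≫ A.lawrenceOrbit K σ) ≫ A.lawrenceToAffine K = y ≫ A.linearSpaceMap K := by
    rw [lawrenceOrbit, Category.assoc, Category.assoc, chart_lawrenceToAffine, ← Category.assoc,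
      ← Spec.map_comp, ← CommRingCat.ofHom_comp]
    refine Spec_map_comp_eq ?_
    have h1 : δ.comp (Ideal.Quotient.mk (A.linearIdeal K)) =
        (MvPolynomial.aeval (R := K) (fun _ : E => (0 : K))).toRingHom :=
      Ideal.Quotient.lift_comp_mk _ _ _
    rw [h1, ← hring]
    rfl
  let p : Spec (CommRingCat.of K) ⟶ A.hypertoric K := pullback.lift _ _ hxy
  let q : Spec (CommRingCat.of K) ⟶ pullback (A.lawrenceEmbedding K) (A.lawrenceOrbit K σ) :=
    pullback.lift p x (pullback.lift_fst _ _ hxy)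
  exact ⟨q (⊥ : PrimeSpectrum K)⟩

/-- The cone of a vertex is the witness: its dimension `rank Ñ` exceeds that of the hypertoric
variety, yet its orbit is met. -/
theorem exists_meets_not_meetsProperly [Module.Free ℤ N] [Module.Finite ℤ N]
    (hA : A.IsPrimitiveSpanning) (h : A.relations ≠ ⊥) :
    ∃ σ : A.lawrenceFan.Cone, A.Meets K σ ∧ ¬ A.MeetsProperly K σ := by
  have := hA.free_nTilde
  obtain ⟨c, hc, e, he⟩ := exists_relation_ne_zero K h
  obtain ⟨I, ξ, hI, hξI, hξ⟩ := hA.exists_vertex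
  let σ : A.lawrenceFan.Cone := ⟨A.lawrenceCone {ξ}, ξ, hξ, IsFace.refl _⟩
  have hmeets : A.Meets K σ := meets_of_forall_notMem σ (coordChar_notMem_perpLattice ξ)
  refine ⟨σ, hmeets, fun hproper => ?_⟩
  have hdim : topologicalKrullDim (A.lawrenceFan.orbitInter K (A.lawrenceEmbedding K) σ) +
      (coneDim (A.lawrenceCone {ξ}) : WithBot ℕ∞) = topologicalKrullDim (A.hypertoric K) :=
    hproper.2
  rw [hA.coneDim_lawrenceCone hI hξI] at hdim
  have hle := topologicalKrullDim_hypertoric_le hc he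
  -- With rank `0` the truncated `rank - 1` would give no contradiction.
  have hpos : 0 < Module.finrank ℤ A.MTilde := by
    have : Nontrivial A.MTilde := by
      refine ⟨A.coordChar e, 0, fun h0 => ?_⟩
      have := LinearMap.congr_fun h0 (A.rhoPos e)
      rw [coordChar_rhoPos, Pi.single_eq_same, LinearMap.zero_apply] at this
      exact one_ne_zero this
    exact Module.finrank_pos
  have : Nonempty (A.lawrenceFan.orbitInter K (A.lawrenceEmbedding K) σ) := hmeets
  have h0 : (0 : WithBot ℕ∞) ≤
      topologicalKrullDim (A.lawrenceFan.orbitInter K (A.lawrenceEmbedding K) σ) :=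
    topologicalKrullDim_nonneg _
  have h1 := (le_add_of_nonneg_left (a := (Module.finrank ℤ A.MTilde : WithBot ℕ∞)) h0).trans
    (hdim.le.trans hle)
  have h2 : Module.finrank ℤ A.MTilde ≤ Module.finrank ℤ A.MTilde - 1 := by exact_mod_cast h1
  omega

end Arrangement

/-! ### Cones generated by a part of a basis -/

namespace Toric

variable {M : Type u} [AddCommGroup M] {ι : Type*} (b : Module.Basis ι ℤ M)

/-- The cone generated by the coordinates in `T`. -/
def basisCone (T : Set ι) : PointedCone ℝ (NReal M) :=
  Submodule.span {c : ℝ // 0 ≤ c} ((fun i => latticeToReal (b.coord i)) '' T)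

theorem coord_mem_basisCone {T : Set ι} {i : ι} (hi : i ∈ T) :
    latticeToReal (b.coord i) ∈ basisCone b T :=
  Submodule.subset_span ⟨i, hi, rfl⟩

theorem mem_dualMonoid_basisCone {T : Set ι} {v : M} :
    v ∈ dualMonoid (basisCone b T) ↔ ∀ i ∈ T, 0 ≤ b.repr v i := by
  constructor
  · intro h i hi
    have h1 : (0 : ℝ) ≤ ((b.coord i v : ℤ) : ℝ) := h _ (coord_mem_basisCone b hi)
    exact_mod_cast h1
  · intro h
    refine nonneg_of_generators _ v ?_
    rintro _ ⟨i, hi, rfl⟩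
    exact Int.cast_nonneg (h i hi)

variable [Fintype ι]

/-- The basis of the real space given by the coordinates with respect to a basis of the lattice. -/
noncomputable def realBasis : Module.Basis ι ℝ (NReal M) :=
  Module.Basis.ofEquivFun (b.constr (M' := ℝ) ℝ).symm

theorem realBasis_apply (i : ι) : realBasis b i = latticeToReal (b.coord i) := by
  classical
  refine b.ext fun j => ?_
  simp [realBasis, latticeToReal, Finsupp.single_apply, Pi.single_apply, eq_comm]

theorem realBasis_repr (x : NReal M) (i : ι) : (realBasis b).repr x i = x (b i) := by
  rw [← Module.Basis.equivFun_apply]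
  rfl

theorem apply_eq_sum (x : NReal M) (v : M) : x v = ∑ i, x (b i) * b.repr v i := by
  conv_lhs => rw [← b.sum_repr v]
  rw [map_sum]
  refine Finset.sum_congr rfl fun i _ => ?_
  rw [map_smul, zsmul_eq_mul, mul_comm]

theorem mem_basisCone {T : Set ι} {x : NReal M} :
    x ∈ basisCone b T ↔ (∀ i, 0 ≤ x (b i)) ∧ ∀ i ∉ T, x (b i) = 0 := by
  classical
  constructor
  · intro hx
    induction hx using Submodule.span_induction with
    | mem x hx =>
      obtain ⟨i, hi, rfl⟩ := hx
      have h : ∀ j, latticeToReal (b.coord i) (b j) = if j = i then 1 else 0 := by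
        intro j
        simp [latticeToReal, Finsupp.single_apply]
      refine ⟨fun j => ?_, fun j hj => ?_⟩
      · rw [h]; split_ifs <;> norm_num
      · rw [h, if_neg (fun hji : j = i => hj (hji ▸ hi))]
    | zero => simp
    | add x y _ _ hx hy =>
      exact ⟨fun i => add_nonneg (hx.1 i) (hy.1 i), fun i hi => by
        rw [LinearMap.add_apply, hx.2 i hi, hy.2 i hi, add_zero]⟩
    | smul c x _ hx =>
      exact ⟨fun i => mul_nonneg c.2 (hx.1 i), fun i hi => by
        change (c : ℝ) * x (b i) = 0
        rw [hx.2 i hi, mul_zero]⟩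
  · rintro ⟨h1, h2⟩
    have h := (realBasis b).sum_repr x
    rw [← h]
    refine Submodule.sum_mem _ fun i _ => ?_
    rw [realBasis_repr, realBasis_apply]
    by_cases hi : i ∈ T
    · exact Submodule.smul_mem _ (⟨x (b i), h1 i⟩ : {c : ℝ // 0 ≤ c}) (coord_mem_basisCone b hi)
    · rw [h2 i hi, zero_smul]
      exact Submodule.zero_mem _

theorem mem_perpLattice_basisCone {T : Set ι} {v : M} :
    v ∈ perpLattice (basisCone b T) ↔ ∀ i ∈ T, b.repr v i = 0 := by
  constructor
  · intro h i hi
    have h1 : ((b.coord i v : ℤ) : ℝ) = 0 := h _ (coord_mem_basisCone b hi)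
    exact_mod_cast h1
  · intro h x hx
    rw [apply_eq_sum b]
    refine Finset.sum_eq_zero fun i _ => ?_
    by_cases hi : i ∈ T
    · rw [h i hi, Int.cast_zero, mul_zero]
    · rw [((mem_basisCone b).1 hx).2 i hi, zero_mul]

/-- The faces of the cone generated by a basis are generated by parts of the basis. -/
theorem IsFace.exists_eq_basisCone {τ : PointedCone ℝ (NReal M)}
    (h : IsFace τ (basisCone b Set.univ)) : ∃ T : Set ι, τ = basisCone b T := by
  obtain ⟨v, hv, hτ⟩ := h
  rw [mem_dualMonoid_basisCone] at hv
  -- On the cone, `x v` is a sum of nonnegative terms. It vanishes exactly when `x` is supported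
  -- where the coordinates of `v` are zero.
  refine ⟨{i | b.repr v i = 0}, Submodule.ext fun x => ?_⟩
  rw [hτ, mem_basisCone, mem_basisCone, apply_eq_sum b]
  simp only [Set.mem_univ, not_true_eq_false, false_imp_iff, implies_true, and_true,
    Set.mem_ofPred_eq]
  refine and_congr_right fun hx => ?_
  rw [Finset.sum_eq_zero_iff_of_nonneg
    (fun i _ => mul_nonneg (hx i) (Int.cast_nonneg (hv i (Set.mem_univ i))))]
  refine forall_congr' fun i => ?_
  rw [mul_eq_zero, Int.cast_eq_zero]
  simp only [Finset.mem_univ, true_imp_iff]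
  tauto

theorem coneDim_basisCone (T : Set ι) : coneDim (basisCone b T) = Nat.card T := by
  classical
  have h : Submodule.span ℝ (basisCone b T : Set (NReal M)) =
      Submodule.span ℝ (Set.range fun i : T => realBasis b i) := by
    rw [basisCone, Submodule.span_span_of_tower, Set.image_eq_range]
    simp only [realBasis_apply]
  have hli : LinearIndependent ℝ fun i : T => realBasis b i :=
    (realBasis b).linearIndependent.comp _ Subtype.val_injective
  rw [coneDim, h, finrank_span_eq_card hli, Nat.card_eq_fintype_card]

/-- The lattice orthogonal to a part of a basis. -/
theorem exists_perpLattice_equiv (T : Set ι) :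
    Nonempty (perpLattice (basisCone b T) ≃+ ((Tᶜ : Set ι) → ℤ)) := by
  classical
  let f : perpLattice (basisCone b T) →+ ((Tᶜ : Set ι) → ℤ) :=
    { toFun := fun v i => b.repr v.1 i
      map_zero' := by ext; simp
      map_add' := fun v w => by ext; simp }
  refine ⟨AddEquiv.ofBijective f ⟨?_, fun z => ?_⟩⟩
  · rw [injective_iff_map_eq_zero]
    intro v hv
    refine Subtype.ext (b.ext_elem fun i => ?_)
    rw [AddSubgroup.coe_zero, map_zero, Finsupp.zero_apply]
    by_cases hi : i ∈ T
    · exact (mem_perpLattice_basisCone b).1 v.2 i hi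
    · exact congrFun hv ⟨i, hi⟩
  · let w : M := b.equivFun.symm fun i => if hi : i ∈ T then 0 else z ⟨i, hi⟩
    have hw : ∀ i, b.repr w i = if hi : i ∈ T then 0 else z ⟨i, hi⟩ := fun i => by
      rw [← Module.Basis.equivFun_apply, LinearEquiv.apply_symm_apply]
    refine ⟨⟨w, (mem_perpLattice_basisCone b).2 fun i hi => ?_⟩, funext fun i => ?_⟩
    · rw [hw, dif_pos hi]
    · exact (hw i).trans (dif_neg i.2)

/-- The cone uses the coordinates in `T`, and its orthogonal lattice is free on the remaining ones.
-/
theorem ringKrullDim_perpLattice_add_coneDim (K : Type*) [Field K] (T : Set ι) :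
    ringKrullDim (AddMonoidAlgebra K (perpLattice (basisCone b T))) +
      (coneDim (basisCone b T) : WithBot ℕ∞) = Fintype.card ι := by
  classical
  obtain ⟨e⟩ := exists_perpLattice_equiv b T
  rw [ringKrullDim_eq_of_ringEquiv (AddMonoidAlgebra.domCongr K K e).toRingEquiv,
    ringKrullDim_addMonoidAlgebra, coneDim_basisCone, Module.finrank_fintype_fun_eq_card,
    ← Nat.card_eq_fintype_card, ← Nat.card_eq_fintype_card]
  have := Nat.card_congr (Equiv.Set.sumCompl T)
  rw [Nat.card_sum] at this
  rw [← this]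
  push_cast
  exact add_comm _ _

/-- The monoid dual to a basis. -/
theorem exists_dualMonoid_equiv :
    Nonempty ((ι →₀ ℕ) ≃+ dualMonoid (basisCone b Set.univ)) := by
  let g : (ι →₀ ℕ) →+ M := b.repr.symm.toLinearMap.toAddMonoidHom.comp
    (Finsupp.mapRange.addMonoidHom (Nat.castAddMonoidHom ℤ))
  have hg : ∀ v i, b.repr (g v) i = v i := fun v i => by
    change b.repr (b.repr.symm _) i = _
    rw [LinearEquiv.apply_symm_apply]
    rfl
  let f : (ι →₀ ℕ) →+ dualMonoid (basisCone b Set.univ) := g.codRestrict _ fun v =>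
    (mem_dualMonoid_basisCone b).2 fun i _ => by rw [hg]; exact Int.natCast_nonneg _
  refine ⟨AddEquiv.ofBijective f ⟨fun v w h => ?_, fun v => ?_⟩⟩
  · ext i
    have : g v = g w := congrArg Subtype.val h
    have h1 := hg v i
    rw [this, hg] at h1
    exact_mod_cast h1.symm
  · refine ⟨Finsupp.equivFunOnFinite.symm fun i => (b.repr v.1 i).toNat,
      Subtype.ext (b.ext_elem fun i => ?_)⟩
    refine (hg _ i).trans ?_
    exact Int.toNat_of_nonneg ((mem_dualMonoid_basisCone b).1 v.2 i (Set.mem_univ i))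

/-- The affine toric variety of the cone generated by a basis is an affine space. -/
theorem exists_coordRing_algEquiv (K : Type u) [Field K] (n : ℕ) (hn : Fintype.card ι = n) :
    Nonempty (MvPolynomial (Fin n) K ≃ₐ[K] CoordRing K (basisCone b Set.univ)) := by
  obtain ⟨e⟩ := exists_dualMonoid_equiv b
  exact ⟨(MvPolynomial.renameEquiv K (Fintype.equivFinOfCardEq hn).symm).trans
    (AddMonoidAlgebra.domCongr K K e)⟩

end Toric

/-! ### Translates of the coordinate arrangement -/

namespace Arrangement

variable {E N : Type u} [AddCommGroup N] {A : Arrangement E N}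

/-- Since `H_e` is a translate of the hyperplane `b_e^⊥`, every real functional that kills `b_e`
kills `a_e`. Testing with the coordinate functionals makes `a_e` an integer multiple of `b_e`, and
primitivity makes the factor a unit. -/
theorem IsTranslateOfCoordinate.exists_basis (hA : A.IsPrimitiveSpanning)
    (h : A.IsTranslateOfCoordinate) : ∃ b : Module.Basis E ℤ N, ∀ e, b e = A.a e := by
  classical
  obtain ⟨b, t, hb⟩ := h
  have h1 : ∀ e, ∀ m : MReal N, m (b e) = 0 → m (A.a e) = 0 := by
    intro e m hm
    have h2 : t + 0 ∈ A.hyperplane e := by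
      rw [hb]; exact ⟨0, rfl, rfl⟩
    have h3 : t + m ∈ A.hyperplane e := by
      rw [hb]; exact ⟨m, hm, rfl⟩
    have h4 : (t + 0) (A.a e) + (A.r e : ℝ) = 0 := h2
    have h5 : (t + m) (A.a e) + (A.r e : ℝ) = 0 := h3
    rw [add_zero] at h4
    rw [LinearMap.add_apply] at h5
    linarith
  have h2 : ∀ e, A.a e = b.repr (A.a e) e • b e := by
    intro e
    refine b.ext_elem fun f => ?_
    rw [map_smul, Finsupp.smul_apply, b.repr_self, smul_eq_mul, Finsupp.single_apply]
    split_ifs with hef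
    · rw [mul_one, hef]
    · have h3 := h1 e ((Int.castAddHom ℝ).toIntLinearMap ∘ₗ b.coord f) (by
        simp [hef])
      have h4 : ((b.repr (A.a e) f : ℤ) : ℝ) = 0 := h3
      rw [mul_zero]
      exact_mod_cast h4
  let w : E → ℤˣ := fun e => (hA.primitive e _ _ (h2 e)).unit
  refine ⟨b.unitsSMul w, fun e => ?_⟩
  rw [Module.Basis.unitsSMul_apply]
  exact (h2 e).symm

/-- The translation vector is the common point of the hyperplanes, with values `-r_e` on the basis.
-/
theorem isTranslateOfCoordinate_of_basis {b : Module.Basis E ℤ N} (hb : ∀ e, b e = A.a e) :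
    A.IsTranslateOfCoordinate := by
  refine ⟨b, b.constr ℤ fun e => -(A.r e : ℝ), fun e => Set.ext fun m => ?_⟩
  have ht : (b.constr ℤ fun e => -(A.r e : ℝ)) (A.a e) = -(A.r e : ℝ) := by
    rw [← hb, b.constr_basis]
  constructor
  · intro hm
    have hm : m (A.a e) + (A.r e : ℝ) = 0 := hm
    refine ⟨m - b.constr ℤ fun e => -(A.r e : ℝ), ?_, add_sub_cancel _ _⟩
    change (m - _) (b e) = 0
    rw [hb, LinearMap.sub_apply, ht]
    linarith
  · rintro ⟨m, hm, rfl⟩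
    have hm : m (b e) = 0 := hm
    change (_ + m) (A.a e) + (A.r e : ℝ) = 0
    rw [LinearMap.add_apply, ht, ← hb, hm]
    ring

/-- A vertex of an arrangement with independent normal vectors lies on all hyperplanes. -/
theorem IsVertex.apply_add_eq_zero {t ξ : MReal N} (ht : ∀ e, t (A.a e) + A.r e = 0)
    (hξ : A.IsVertex ξ) (e : E) : ξ (A.a e) + A.r e = 0 := by
  obtain ⟨m, hm⟩ := hξ
  have h1 : A.sgn ξ = A.sgn m := (Set.ext_iff.1 hm ξ).1 rfl
  -- Dilating by `2` about the common point `t` doubles all the affine forms and preserves their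
  -- signs. It therefore fixes the vertex `ξ`, where each form must equal its own double.
  have h2 : ∀ f, (ξ + (ξ - t)) (A.a f) + A.r f = 2 * (ξ (A.a f) + A.r f) := fun f => by
    rw [LinearMap.add_apply, LinearMap.sub_apply]
    linarith [ht f]
  have h3 : ξ + (ξ - t) = ξ := by
    refine (Set.ext_iff.1 hm (ξ + (ξ - t))).2 ?_
    change A.sgn _ = A.sgn m
    rw [← h1]
    funext f
    rw [sgn, sgn, h2, ← mul_neg, sign_mul, sign_pos two_pos, one_mul]
  have h4 := h2 e
  rw [h3] at h4
  linarith

/-! ### Consequences of the absence of relations. -/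

variable [Fintype E]

theorem relations_eq_bot_of_basis {b : Module.Basis E ℤ N} (hb : ∀ e, b e = A.a e) :
    A.relations = ⊥ := by
  rw [relations, LinearMap.ker_eq_bot]
  have : LinearIndependent ℤ A.a := funext hb ▸ b.linearIndependent
  exact this.fintypeLinearCombination_injective

/-- Without relations the generators `a_e` are independent, hence a basis. -/
theorem IsPrimitiveSpanning.relations_ne_bot (hA : A.IsPrimitiveSpanning)
    (h : ¬ A.IsTranslateOfCoordinate) : A.relations ≠ ⊥ := by
  intro hbot
  have hli : LinearIndependent ℤ A.a := by
    rw [Fintype.linearIndependent_iff]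
    intro c hc
    have : c ∈ A.relations := mem_relations.2 hc
    rw [hbot, Submodule.mem_bot] at this
    exact congrFun this
  exact h (isTranslateOfCoordinate_of_basis (b := Module.Basis.mk hli hA.spanning.ge)
    fun e => Module.Basis.mk_apply _ _ e)

theorem linearIdeal_eq_bot (K : Type u) [Field K] (h : A.relations = ⊥) : A.linearIdeal K = ⊥ := by
  rw [linearIdeal, Ideal.span_eq_bot]
  rintro _ ⟨c, hc, rfl⟩
  rw [h, Submodule.mem_bot] at hc
  simp [hc]

theorem isIso_linearSpaceMap (K : Type u) [Field K] (h : A.relations = ⊥) :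
    IsIso (A.linearSpaceMap K) := by
  have h1 : Function.Bijective (Ideal.Quotient.mk (A.linearIdeal K)) := by
    refine ⟨?_, Ideal.Quotient.mk_surjective⟩
    rw [RingHom.injective_iff_ker_eq_bot, Ideal.mk_ker, linearIdeal_eq_bot K h]
  have : IsIso (CommRingCat.ofHom (Ideal.Quotient.mk (A.linearIdeal K))) :=
    (ConcreteCategory.isIso_iff_bijective _).2 h1
  exact inferInstanceAs (IsIso (Spec.map (CommRingCat.ofHom (Ideal.Quotient.mk (A.linearIdeal K)))))

variable [DecidableEq E]

/-- The `ρ_e^±` are a basis of `Ñ` if there are no relations. -/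
noncomputable def tildeBasis (h : A.relations = ⊥) : Module.Basis (E ⊕ E) ℤ A.NTilde :=
  ((Pi.basisFun ℤ E).prod (Pi.basisFun ℤ E)).map
    (Submodule.quotEquivOfEqBot _ (by rw [h, Submodule.map_bot])).symm

theorem tildeBasis_inl (h : A.relations = ⊥) (e : E) : tildeBasis h (Sum.inl e) = A.rhoPos e := by
  rw [tildeBasis, Module.Basis.map_apply, LinearEquiv.symm_apply_eq]
  simp [rhoPos]

theorem tildeBasis_inr (h : A.relations = ⊥) (e : E) : tildeBasis h (Sum.inr e) = A.rhoNeg e := by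
  rw [tildeBasis, Module.Basis.map_apply, LinearEquiv.symm_apply_eq]
  simp [rhoNeg]

/-- A point on every hyperplane lies in both halfspaces of each, so all the `ρ_e^±` are generators.
The dual basis appears because `basisCone` starts from a basis of the dual lattice of `Ñ`, whose
coordinates are evaluations at the `ρ_e^±`. -/
theorem lawrenceCone_eq_basisCone (h : A.relations = ⊥) {ξ : MReal N}
    (hξ : ∀ e, ξ (A.a e) + A.r e = 0) :
    A.lawrenceCone {ξ} = basisCone (tildeBasis h).dualBasis Set.univ := by
  have hgen : A.coneGenerators {ξ} = Set.range (tildeBasis h) := by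
    ext n
    constructor
    · rintro ⟨e, ⟨-, rfl⟩ | ⟨-, rfl⟩⟩
      · exact ⟨Sum.inl e, tildeBasis_inl h e⟩
      · exact ⟨Sum.inr e, tildeBasis_inr h e⟩
    · rintro ⟨e | e, rfl⟩
      · exact ⟨e, Or.inl ⟨Set.singleton_subset_iff.2 (hξ e).le, tildeBasis_inl h e⟩⟩
      · exact ⟨e, Or.inr ⟨Set.singleton_subset_iff.2 (hξ e).ge, tildeBasis_inr h e⟩⟩
  rw [lawrenceCone, basisCone, hgen, Set.image_univ, ← Set.range_comp]
  congr 2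
  funext i
  change latticeToReal _ = latticeToReal _
  congr 1
  ext f
  simp [Module.Dual.eval_apply]

variable {K : Type u} [Field K]

/-- A cone that has every cone as a face is terminal in the gluing diagram, so the colimit is its
chart. -/
theorem isIso_lawrenceChart {σ : A.lawrenceFan.Cone}
    (hσ : ∀ τ : A.lawrenceFan.Cone, Toric.IsFace τ.cone σ.cone) : IsIso (A.lawrenceChart K σ) := by
  have hT : IsTerminal σ := IsTerminal.ofUniqueHom (fun τ => homOfLE (hσ τ))
    (fun _ _ => Subsingleton.elim _ _)
  exact isIso_ι_of_isTerminal hT (A.lawrenceFan.diagram K)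

/-- The structure morphism of the Lawrence toric variety. -/
noncomputable def lawrenceToSpec (A : Arrangement E N) (K : Type u) [Field K] :
    A.lawrenceVariety K ⟶ Spec (CommRingCat.of K) :=
  A.lawrenceFan.toSpecField K

theorem lawrenceChart_lawrenceToSpec (σ : A.lawrenceFan.Cone) :
    A.lawrenceChart K σ ≫ A.lawrenceToSpec K =
      Spec.map (CommRingCat.ofHom (algebraMap K (CoordRing K σ.cone))) :=
  A.lawrenceFan.chart_toSpecField K σ

/-- If the Lawrence fan has a largest cone whose affine toric variety is an affine space and there
are no relations, then the hypertoric variety is an affine space. -/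
theorem exists_hypertoric_iso (h : A.relations = ⊥) {σ : A.lawrenceFan.Cone}
    (hσ : ∀ τ : A.lawrenceFan.Cone, Toric.IsFace τ.cone σ.cone) {ι : Type}
    (g : MvPolynomial ι K ≃ₐ[K] CoordRing K σ.cone) :
    ∃ φ : A.hypertoric K ≅ Spec (CommRingCat.of (MvPolynomial ι K)),
      φ.hom ≫ Spec.map (CommRingCat.ofHom (algebraMap K _)) = A.hypertoricToSpec K := by
  have := isIso_linearSpaceMap K h
  have := isIso_lawrenceChart (K := K) hσ
  have hemb : IsIso (A.lawrenceEmbedding K) :=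
    inferInstanceAs (IsIso (pullback.fst (A.lawrenceToAffine K) (A.linearSpaceMap K)))
  have hg : IsIso (CommRingCat.ofHom (g : MvPolynomial ι K →ₐ[K] CoordRing K σ.cone).toRingHom) :=
    (ConcreteCategory.isIso_iff_bijective _).2 g.bijective
  refine ⟨asIso (A.lawrenceEmbedding K) ≪≫ (asIso (A.lawrenceChart K σ)).symm ≪≫
    asIso (Spec.map (CommRingCat.ofHom
      (g : MvPolynomial ι K →ₐ[K] CoordRing K σ.cone).toRingHom)), ?_⟩
  simp only [Iso.trans_hom, Iso.symm_hom, asIso_hom, asIso_inv, Category.assoc]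
  rw [← Spec.map_comp, ← CommRingCat.ofHom_comp]
  have hcomp : (g : MvPolynomial ι K →ₐ[K] CoordRing K σ.cone).toRingHom.comp
      (algebraMap K (MvPolynomial ι K)) = algebraMap K (CoordRing K σ.cone) :=
    (g : MvPolynomial ι K →ₐ[K] CoordRing K σ.cone).comp_algebraMap
  rw [hcomp, ← lawrenceChart_lawrenceToSpec, IsIso.inv_hom_id_assoc]
  rfl

/-- Without relations the linear subspace is all of `𝔸^E`, so the embedding is an isomorphism and
the intersection is the orbit itself. -/
theorem exists_orbitInter_iso (h : A.relations = ⊥) (σ : A.lawrenceFan.Cone) :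
    Nonempty (A.lawrenceFan.orbitInter K (A.lawrenceEmbedding K) σ ≅ torusOrbit K σ.cone) := by
  have := isIso_linearSpaceMap K h
  have hemb : IsIso (A.lawrenceEmbedding K) :=
    inferInstanceAs (IsIso (pullback.fst (A.lawrenceToAffine K) (A.linearSpaceMap K)))
  rw [orbitInter_eq]
  exact ⟨asIso (pullback.snd (A.lawrenceEmbedding K) (A.lawrenceOrbit K σ))⟩

end Arrangement

theorem corollary5p2 {K E N : Type u} [Field K] [Fintype E] [DecidableEq E]
    [AddCommGroup N] [Module.Free ℤ N] [Module.Finite ℤ N]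
    (A : Arrangement E N) (hA : A.IsPrimitiveSpanning) :
    (¬ A.IsTranslateOfCoordinate → ∃ σ : A.lawrenceFan.Cone, A.Meets K σ ∧ ¬ A.MeetsProperly K σ) ∧
    (A.IsTranslateOfCoordinate →
      (∀ σ : A.lawrenceFan.Cone, A.MeetsProperly K σ) ∧
      ∃ φ : A.hypertoric K ≅
          Spec (CommRingCat.of (MvPolynomial (Fin (2 * Module.finrank ℤ N)) K)),
        φ.hom ≫ Spec.map (CommRingCat.ofHom (algebraMap K _)) = A.hypertoricToSpec K) := by
  refine ⟨fun h => Arrangement.exists_meets_not_meetsProperly hA (hA.relations_ne_bot h),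
    fun h => ?_⟩
  obtain ⟨b, hb⟩ := h.exists_basis hA
  have hrel := Arrangement.relations_eq_bot_of_basis hb
  let t : Arrangement.MReal N := b.constr ℤ fun e => -(A.r e : ℝ)
  have ht : ∀ e, t (A.a e) + A.r e = 0 := fun e => by
    rw [← hb, b.constr_basis, neg_add_cancel]
  let u := (Arrangement.tildeBasis hrel).dualBasis
  have hcone : ∀ ξ, A.IsVertex ξ → A.lawrenceCone {ξ} = basisCone u Set.univ := fun ξ hξ =>
    Arrangement.lawrenceCone_eq_basisCone hrel (hξ.apply_add_eq_zero ht)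
  have hface : ∀ τ : A.lawrenceFan.Cone, Toric.IsFace τ.cone (basisCone u Set.univ) := by
    rintro ⟨τ, ξ, hξ, hτ⟩
    rwa [hcone ξ hξ] at hτ
  -- The existence of a vertex is needed here: otherwise the fan would be empty.
  have hmem : basisCone u Set.univ ∈ A.lawrenceFan.cones := by
    obtain ⟨-, ξ, -, -, hξ⟩ := hA.exists_vertex
    exact ⟨ξ, hξ, hcone ξ hξ ▸ Toric.IsFace.refl _⟩
  have hcard : Fintype.card (E ⊕ E) = 2 * Module.finrank ℤ N := by
    rw [Fintype.card_sum, Module.finrank_eq_card_basis b, two_mul]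
  obtain ⟨g⟩ := exists_coordRing_algEquiv u K _ hcard
  obtain ⟨φ, hφ⟩ := Arrangement.exists_hypertoric_iso hrel
    (σ := ⟨basisCone u Set.univ, hmem⟩) hface g
  refine ⟨fun σ => ?_, φ, hφ⟩
  obtain ⟨i⟩ := Arrangement.exists_orbitInter_iso (K := K) hrel σ
  obtain ⟨T, hT⟩ := (hface σ).exists_eq_basisCone u
  refine ⟨⟨i.inv (Classical.arbitrary (PrimeSpectrum (AddMonoidAlgebra K (perpLattice σ.cone))))⟩, ?_⟩
  change topologicalKrullDim (A.lawrenceFan.orbitInter K (A.lawrenceEmbedding K) σ) +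
    (coneDim σ.cone : WithBot ℕ∞) = topologicalKrullDim (A.hypertoric K)
  rw [(Scheme.homeoOfIso i).isHomeomorph.topologicalKrullDim_eq,
    (Scheme.homeoOfIso φ).isHomeomorph.topologicalKrullDim_eq, topologicalKrullDim_Spec,
    topologicalKrullDim_Spec]
  change ringKrullDim (AddMonoidAlgebra K (perpLattice σ.cone)) + _ =
    ringKrullDim (MvPolynomial (Fin (2 * Module.finrank ℤ N)) K)
  rw [hT, ringKrullDim_perpLattice_add_coneDim, MvPolynomial.ringKrullDim_of_isNoetherianRing,
    ringKrullDim_eq_zero_of_field, zero_add, Nat.card_fin, hcard]
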